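/- Let $B^1=(B^1_r)_{r\ge 0}$ and $B^2=(B^2_r)_{r\ge 0}$ be independent $d$-dimensional standard Brownian motions on a probability space $(\Omega,\mathcal F,P)$. Let $\mu$ be a tempered (nonnegative) measure on $\mathbb{R}^d$ whose Fourier transform is a real function $f$, with the normalization $f(x)=(2\pi)^{-d}\int_{\mathbb{R}^d}e^{-i\xi\cdot x}\mu(d\xi)$ understood in the sense of tempered distributions: for every Schwartz function $\varphi$ on $\mathbb{R}^d$, $f\varphi$ is Lebesgue integrable and $\int f\varphi\,dx=(2\pi)^{-d}\int\big(\int e^{-i\xi\cdot x}\varphi(x)\,dx\big)\mu(d\xi)$. Let $p_\varepsilon(x)=(2\pi\varepsilon)^{-d/2}e^{-|x|^2/(2\varepsilon)}$. Let $t>0$ and let $\eta:[0,t]^2\to\mathbb{R}_+$ be a measurable function with $\eta(r,s)=\eta(t-r,t-s)$ for all $r,s\in[0,t]$. For $\varepsilon>0$ put $$L_{t,\varepsilon}(\eta)=\int_0^t\int_0^t\int_{\mathbb{R}^d}\eta(r,s)\,p_\varepsilon(B^1_r-B^2_s-y)f(y)\,dy\,dr\,ds,$$ and for $n\ge 1$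 put $$\alpha_n(t,\eta)=\int_{[0,t]^{2n}}\prod_{j=1}^n\eta(s_j,t_j)\,\psi^{(n)}(\mathbf s,\mathbf t)\,d\mathbf s\,d\mathbf t\in[0,\infty],$$ $$\psi^{(n)}(\mathbf s,\mathbf t)=(2\pi)^{-nd}\int_{(\mathbb{R}^d)^n}\exp\Big\{-\frac12\sum_{j,k=1}^n(s_j\wedge s_k+t_j\wedge t_k)\,\xi_j\cdot\xi_k\Big\}\mu(d\xi_1)\cdots\mu(d\xi_n).$$ a) If $\alpha_2(t,\eta)<\infty$, then for every $\varepsilon>0$ the integral defining $L_{t,\varepsilon}(\eta)$ converges absolutely almost surely and $L_{t,\varepsilon}(\eta)\in L^2(\Omega)$; moreover $$\lim_{\varepsilon,\delta\downarrow 0}E\big(L_{t,\varepsilon}(\eta)L_{t,\delta}(\eta)\big)=\alpha_2(t,\eta),$$ and there exists a random variable $L_t(\eta)=\lim_{\varepsilon\downarrow 0}L_{t,\varepsilon}(\eta)$ in $L^2(\Omega)$. b) If $\alpha_n(t,\eta)<\infty$ for all $n\ge 1$, then for every real $p\ge 2$ the variables $L_{t,\varepsilon}(\eta)$, $\varepsilon>0$,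 and the random variable $L_t(\eta)$ from part a) are $p$-integrable, and $$\lim_{\varepsilon\downarrow 0}E\big|L_{t,\varepsilon}(\eta)-L_t(\eta)\big|^p=0.$$ In particular, $E(L_t(\eta)^n)=\lim_{\varepsilon\downarrow 0}E(L_{t,\varepsilon}(\eta)^n)=\alpha_n(t,\eta)$ for all $n\ge 1$. -/

import Mathlib

open MeasureTheory ProbabilityTheory Filter Topology
open scoped NNReal ENNReal RealInnerProductSpace SchwartzMap

namespace ConvolutedLocalTime

/-- `B` is a `d`-dimensional standard Brownian motion: its coordinates are independent
one-dimensional standard Brownian motions (with almost surely continuous paths). -/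
structure IsBrownian {Ω : Type*} [MeasurableSpace Ω] {d : ℕ}
    (B : ℝ≥0 → Ω → EuclideanSpace ℝ (Fin d)) (P : Measure Ω) : Prop where
  coord : ∀ i : Fin d, IsBrownianReal (fun u ω => B u ω i) P
  indep : iIndepFun (fun (i : Fin d) (ω : Ω) (u : ℝ≥0) => B u ω i) P

/-- The function `f` on `ℝ^d` is the Fourier transform of the tempered (nonnegative) measure `μ`,
`f(x) = (2π)^{-d} ∫ e^{-i ξ·x} μ(dξ)`, in the sense of tempered distributions:
`∫ f φ dx = (2π)^{-d} ∫ (∫ e^{-i ξ·x} φ(x) dx) μ(dξ)` for all Schwartz functions `φ`, where the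
integral on the left converges absolutely. -/
structure IsFourierTransformOf {d : ℕ} (f : EuclideanSpace ℝ (Fin d) → ℝ)
    (μ : Measure (EuclideanSpace ℝ (Fin d))) : Prop where
  temperate : μ.HasTemperateGrowth
  integrable : ∀ φ : 𝓢(EuclideanSpace ℝ (Fin d), ℂ), Integrable (fun x => (f x : ℂ) * φ x)
  fourier : ∀ φ : 𝓢(EuclideanSpace ℝ (Fin d), ℂ),
    ∫ x, (f x : ℂ) * φ x =
      (((2 * Real.pi) ^ d)⁻¹ : ℝ) *
        ∫ ξ, (∫ x, Complex.exp (-(Complex.I * (⟪ξ, x⟫ : ℝ))) * φ x) ∂μ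

/-- The heat kernel `p_ε(x) = (2πε)^{-d/2} exp(-|x|²/(2ε))` on `ℝ^d`. -/
noncomputable def heatKernel {d : ℕ} (ε : ℝ) (x : EuclideanSpace ℝ (Fin d)) : ℝ :=
  (2 * Real.pi * ε) ^ (-(d : ℝ) / 2) * Real.exp (-‖x‖ ^ 2 / (2 * ε))

/-- The integrand `η(r,s) p_ε(B¹_r - B²_s - y) f(y)` at the sample point `ω`. -/
noncomputable def integrand {Ω : Type*} {d : ℕ} (B₁ B₂ : ℝ≥0 → Ω → EuclideanSpace ℝ (Fin d))
    (f : EuclideanSpace ℝ (Fin d) → ℝ) (η : ℝ → ℝ → ℝ) (ε : ℝ) (ω : Ω)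
    (r s : ℝ) (y : EuclideanSpace ℝ (Fin d)) : ℝ :=
  η r s * heatKernel ε (B₁ r.toNNReal ω - B₂ s.toNNReal ω - y) * f y

/-- The approximate convoluted intersection local time
`L_{t,ε}(η) = ∫_0^t ∫_0^t ∫_{ℝ^d} η(r,s) p_ε(B¹_r - B²_s - y) f(y) dy dr ds`. -/
noncomputable def approxLocalTime {Ω : Type*} {d : ℕ}
    (B₁ B₂ : ℝ≥0 → Ω → EuclideanSpace ℝ (Fin d))
    (f : EuclideanSpace ℝ (Fin d) → ℝ) (t : ℝ) (η : ℝ → ℝ → ℝ) (ε : ℝ) (ω : Ω) : ℝ :=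
  ∫ s in Set.Icc 0 t, ∫ r in Set.Icc 0 t, ∫ y, integrand B₁ B₂ f η ε ω r s y

/-- `σ_{jk} = s_j ∧ s_k + t_j ∧ t_k`. -/
noncomputable def sigma {n : ℕ} (s t : Fin n → ℝ) (j k : Fin n) : ℝ :=
  min (s j) (s k) + min (t j) (t k)

/-- `ψ^{(n)}(s,t) = (2π)^{-nd} ∫_{(ℝ^d)^n} exp(-½ ∑_{j,k} σ_{jk} ξ_j·ξ_k) μ(dξ_1)⋯μ(dξ_n)`,
a number in `[0,∞]`. -/
noncomputable def psi {d : ℕ} (μ : Measure (EuclideanSpace ℝ (Fin d))) (n : ℕ)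
    (s t : Fin n → ℝ) : ℝ≥0∞ :=
  ENNReal.ofReal ((2 * Real.pi) ^ (n * d))⁻¹ *
    ∫⁻ ξ : Fin n → EuclideanSpace ℝ (Fin d),
      ENNReal.ofReal (Real.exp (-(1 / 2) * ∑ j, ∑ k, sigma s t j k * ⟪ξ j, ξ k⟫))
      ∂(Measure.pi fun _ => μ)

/-- `α_n(t,η) = ∫_{[0,t]^{2n}} ∏_j η(s_j,t_j) ψ^{(n)}(s,t) ds dt`, a number in `[0,∞]`. -/
noncomputable def alpha {d : ℕ} (μ : Measure (EuclideanSpace ℝ (Fin d))) (t : ℝ)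
    (η : ℝ → ℝ → ℝ) (n : ℕ) : ℝ≥0∞ :=
  ∫⁻ q in Set.Icc (0 : Fin n → ℝ) (fun _ => t) ×ˢ Set.Icc (0 : Fin n → ℝ) (fun _ => t),
    ENNReal.ofReal (∏ j, η (q.1 j) (q.2 j)) * psi μ n q.1 q.2

end ConvolutedLocalTime

open ConvolutedLocalTime

/-!
The proof passes to Fourier space. Testing the hypothesis on `f` against heat kernels shows that
`p_ε * f` is the Fourier transform of the finite measure `(2π)^{-d} exp (-ε‖ξ‖²/2) μ(dξ)`
(`IsFourierTransformOf.integral_heatKernel_mul`), so that along continuous paths `L_{t,ε}(η)` is an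
oscillatory integral
`(2π)^{-d} ∫ η(r,s) exp (-ε‖ξ‖²/2) exp (-i ξ·(B¹_r - B²_s)) dr ds μ(dξ)`
over `[0,t]² × ℝ^d` (`approxLocalTime_eq`). Its weight is integrable: `α₂ < ∞` forces `η` to be
integrable unless `μ = 0`, in which case `f = 0` almost everywhere
(`integrable_of_alpha_two_lt_top`, `IsFourierTransformOf.ae_eq_zero`).

By Fubini, the expectation of a product of such integrals involves only the joint characteristic
function of the Gaussian variables `ξ_j·(B¹_{r_j} - B²_{s_j})`, which is
`exp (-½ ∑ σ_{jk} ξ_j·ξ_k)`. Hence `E ∏_j L_{t,ε_j}(η)` is the integral that defines `α_n`, with the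
extra factor `∏_j exp (-ε_j‖ξ_j‖²/2)` (`integral_prod_approxLocalTime`). This factor lies in `(0,1]`
and the rest of the integrand is nonnegative, so dominated convergence gives
`E ∏_j L_{t,ε_j}(η) → α_n` as all `ε_j ↓ 0` (`tendsto_integral_prod_weight`).

For `n = 2` the inner products in `L²` converge, so the family is Cauchy
(`exists_tendsto_eLpNorm_two`). If all `α_n` are finite, the family is eventually bounded in every
`L^{2n}`, and so is its limit by Fatou's lemma; the Cauchy-Schwarz inequality then improves `L²`
convergence to convergence in `L^p` (`tendsto_lintegral_enorm_sub_rpow`) and of all moments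
(`tendsto_integral_pow`).
-/

namespace ConvolutedLocalTime

/-! ### Gaussians as Schwartz functions and heat kernel regularization -/

lemma exists_one_add_pow_mul_exp_le {c : ℝ} (hc : 0 < c) (N : ℕ) :
    ∃ C : ℝ, ∀ r : ℝ, 0 ≤ r → (1 + r) ^ N * Real.exp (-c * r ^ 2) ≤ C := by
  refine ⟨N.factorial * Real.exp (1 + 1 / (4 * c)), fun r hr => ?_⟩
  have h1 : (1 + r) ^ N ≤ N.factorial * Real.exp (1 + r) := by
    have := Real.pow_div_factorial_le_exp (1 + r) (by linarith) N
    rwa [div_le_iff₀ (by positivity), mul_comm] at this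
  have h2 : 1 + r + -c * r ^ 2 ≤ 1 + 1 / (4 * c) := by
    have : 0 ≤ (2 * c * r - 1) ^ 2 / (4 * c) := by positivity
    have e : (2 * c * r - 1) ^ 2 / (4 * c) = c * r ^ 2 - r + 1 / (4 * c) := by field_simp; ring
    linarith
  calc (1 + r) ^ N * Real.exp (-c * r ^ 2)
      ≤ N.factorial * Real.exp (1 + r) * Real.exp (-c * r ^ 2) := by gcongr
    _ = N.factorial * Real.exp (1 + r + -c * r ^ 2) := by rw [Real.exp_add (1 + r)]; ring
    _ ≤ _ := by gcongr

/-- A Gaussian centred at `x` is dominated by a wider Gaussian centred at the origin. -/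
lemma neg_norm_sub_sq_le {V : Type*} [NormedAddCommGroup V] (x y : V) :
    -‖x - y‖ ^ 2 ≤ ‖x‖ ^ 2 - ‖y‖ ^ 2 / 2 := by
  have h : ‖y‖ ≤ ‖x - y‖ + ‖x‖ := by
    have := norm_sub_le x (x - y)
    rw [sub_sub_cancel] at this
    linarith
  nlinarith [norm_nonneg (x - y), norm_nonneg x, norm_nonneg y, sq_nonneg (‖x - y‖ - ‖x‖)]

section Gaussian

variable {V : Type} [NormedAddCommGroup V] [InnerProductSpace ℝ V]

lemma hasFDerivAt_exp_neg_norm_sub_sq (b : ℝ) (x y : V) :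
    HasFDerivAt (fun y => Real.exp (-b * ‖x - y‖ ^ 2))
      ((Real.exp (-b * ‖x - y‖ ^ 2) * (2 * b)) • innerSL ℝ (x - y)) y := by
  have h1 : HasFDerivAt (fun y : V => x - y) (-ContinuousLinearMap.id ℝ V) y := by
    simpa using (hasFDerivAt_id (𝕜 := ℝ) y).const_sub x
  have h2 := ((h1.norm_sq).const_mul (-b)).exp
  convert h2 using 1
  ext z
  simp
  ring

/-- Multiplying a function of temperate growth by a Gaussian makes all derivatives decay
rapidly. The target space is general because the derivative of `exp (-b‖x - y‖²) • h y` is of the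
same form, with a new `h` taking values in a space of linear maps. -/
lemma exists_pow_mul_norm_iteratedFDeriv_gaussian_smul_le {b : ℝ} (hb : 0 < b) (x : V) (k n : ℕ) :
    ∀ {F : Type} [NormedAddCommGroup F] [NormedSpace ℝ F] (h : V → F), h.HasTemperateGrowth →
      ∃ C : ℝ, ∀ y, ‖y‖ ^ k *
        ‖iteratedFDeriv ℝ n (fun y => Real.exp (-b * ‖x - y‖ ^ 2) • h y) y‖ ≤ C := by
  induction n with
  | zero =>
    intro F _ _ h hh
    obtain ⟨m, K, hK⟩ := hh.2 0
    obtain ⟨C, hC⟩ := exists_one_add_pow_mul_exp_le (half_pos hb) (k + m)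
    refine ⟨Real.exp (b * ‖x‖ ^ 2) * |K| * C, fun y => ?_⟩
    have h1 : ‖h y‖ ≤ |K| * (1 + ‖y‖) ^ m := by
      have := hK y
      simp only [norm_iteratedFDeriv_zero] at this
      exact this.trans (by gcongr; exact le_abs_self K)
    have h2 : Real.exp (-b * ‖x - y‖ ^ 2)
        ≤ Real.exp (b * ‖x‖ ^ 2) * Real.exp (-(b / 2) * ‖y‖ ^ 2) := by
      rw [← Real.exp_add]
      have := neg_norm_sub_sq_le x y
      gcongr
      nlinarith
    rw [norm_iteratedFDeriv_zero, norm_smul, Real.norm_of_nonneg (Real.exp_pos _).le]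
    calc ‖y‖ ^ k * (Real.exp (-b * ‖x - y‖ ^ 2) * ‖h y‖)
        ≤ (1 + ‖y‖) ^ k * ((Real.exp (b * ‖x‖ ^ 2) * Real.exp (-(b / 2) * ‖y‖ ^ 2)) *
            (|K| * (1 + ‖y‖) ^ m)) := by
          gcongr
          linarith
      _ = Real.exp (b * ‖x‖ ^ 2) * |K| *
            ((1 + ‖y‖) ^ (k + m) * Real.exp (-(b / 2) * ‖y‖ ^ 2)) := by rw [pow_add]; ring
      _ ≤ _ := by gcongr; exact hC _ (norm_nonneg y)
  | succ n ih =>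
    intro F _ _ h hh
    have hd : Differentiable ℝ h := hh.1.differentiable (by simp)
    have e : fderiv ℝ (fun y => Real.exp (-b * ‖x - y‖ ^ 2) • h y) = fun y =>
        Real.exp (-b * ‖x - y‖ ^ 2) • (fderiv ℝ h y + (2 * b) •
          ContinuousLinearMap.smulRightL ℝ V F (innerSL ℝ (x - y)) (h y)) := by
      ext1 y
      rw [((hasFDerivAt_exp_neg_norm_sub_sq b x y).fun_smul (hd y).hasFDerivAt).fderiv]
      ext z
      simp only [add_apply, smul_apply,
        ContinuousLinearMap.smulRight_apply, ContinuousLinearMap.smulRightL_apply_apply, smul_add,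
        smul_smul, smul_eq_mul]
    have ht : (fun y => fderiv ℝ h y + (2 * b) •
          ContinuousLinearMap.smulRightL ℝ V F (innerSL ℝ (x - y)) (h y)).HasTemperateGrowth := by
      have h1 : (fderiv ℝ h).HasTemperateGrowth := by
        refine ⟨hh.1.fderiv_right (by simp), fun j => ?_⟩
        obtain ⟨m, K, hK⟩ := hh.2 (j + 1)
        refine ⟨m, K, fun y => ?_⟩
        rw [norm_iteratedFDeriv_fderiv]
        exact hK y
      have h2 : (fun y => innerSL ℝ (x - y)).HasTemperateGrowth := by
        have h0 : (innerSL ℝ : V → V →L[ℝ] ℝ).HasTemperateGrowth :=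
          (innerSL ℝ : V →L[ℝ] V →L[ℝ] ℝ).hasTemperateGrowth
        simp only [map_sub]
        exact (Function.HasTemperateGrowth.const _).sub h0
      have h3 := (ContinuousLinearMap.smulRightL ℝ V F).bilinear_hasTemperateGrowth h2 hh
      fun_prop
    obtain ⟨C, hC⟩ := ih _ ht
    refine ⟨C, fun y => ?_⟩
    rw [← norm_iteratedFDeriv_fderiv, e]
    exact hC y

/-- The Gaussian `y ↦ exp (-b‖x - y‖²)` as a complex valued Schwartz function. -/
noncomputable def gaussianSchwartz {b : ℝ} (hb : 0 < b) (x : V) : 𝓢(V, ℂ) where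
  toFun y := Real.exp (-b * ‖x - y‖ ^ 2) • (1 : ℂ)
  smooth' := by
    refine ContDiff.smul (𝕜 := ℝ) (f := fun y : V => Real.exp (-b * ‖x - y‖ ^ 2)) ?_ contDiff_const
    exact (contDiff_const.mul ((contDiff_const.sub contDiff_id).norm_sq ℝ)).exp
  decay' k n :=
    exists_pow_mul_norm_iteratedFDeriv_gaussian_smul_le hb x k n _ (.const 1)

lemma gaussianSchwartz_apply {b : ℝ} (hb : 0 < b) (x y : V) :
    gaussianSchwartz hb x y = (Real.exp (-b * ‖x - y‖ ^ 2) : ℂ) := by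
  change Real.exp (-b * ‖x - y‖ ^ 2) • (1 : ℂ) = _
  simp

end Gaussian

variable {d : ℕ}

local notation "𝔼" => EuclideanSpace ℝ (Fin d)

lemma heatKernel_sub_eq (ε : ℝ) (hε : 0 < ε) (x y : 𝔼) :
    (heatKernel ε (x - y) : ℂ) =
      ((2 * Real.pi * ε) ^ (-(d : ℝ) / 2) : ℝ) *
        gaussianSchwartz (b := (2 * ε)⁻¹) (by positivity) x y := by
  rw [gaussianSchwartz_apply, heatKernel, ← Complex.ofReal_mul]
  congr 3
  ring

/-- The Fourier transform of the heat kernel centred at `x`. -/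
lemma integral_cexp_inner_mul_heatKernel (ε : ℝ) (hε : 0 < ε) (x ξ : 𝔼) :
    ∫ y, Complex.exp (-(Complex.I * (⟪ξ, y⟫ : ℝ))) * (heatKernel ε (x - y) : ℂ) =
      (Real.exp (-(ε / 2) * ‖ξ‖ ^ 2) : ℂ) * Complex.exp (-(Complex.I * (⟪ξ, x⟫ : ℝ))) := by
  have hb : 0 < (((2 * ε)⁻¹ : ℝ) : ℂ).re := by
    rw [Complex.ofReal_re]
    positivity
  have h := GaussianFourier.integral_cexp_neg_mul_sq_norm_add hb Complex.I ξ
  rw [← integral_sub_left_eq_self _ volume x]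
  simp only [sub_sub_cancel]
  have e : ∀ y : 𝔼, Complex.exp (-(Complex.I * (⟪ξ, x - y⟫ : ℝ))) * (heatKernel ε y : ℂ) =
      (Complex.exp (-(Complex.I * (⟪ξ, x⟫ : ℝ))) *
        ((2 * Real.pi * ε) ^ (-(d : ℝ) / 2) : ℝ)) *
        Complex.exp (-(((2 * ε)⁻¹ : ℝ) : ℂ) * ‖y‖ ^ 2 + Complex.I * (⟪ξ, y⟫ : ℝ)) := by
    intro y
    have e1 : Complex.exp (-(Complex.I * (⟪ξ, x - y⟫ : ℝ))) *
        Complex.exp ((-‖y‖ ^ 2 / (2 * ε) : ℝ) : ℂ) = Complex.exp (-(Complex.I * (⟪ξ, x⟫ : ℝ))) *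
        Complex.exp (-(((2 * ε)⁻¹ : ℝ) : ℂ) * ‖y‖ ^ 2 + Complex.I * (⟪ξ, y⟫ : ℝ)) := by
      rw [← Complex.exp_add, ← Complex.exp_add, inner_sub_right]
      congr 1
      push_cast
      ring
    rw [heatKernel, Complex.ofReal_mul, Complex.ofReal_exp, mul_left_comm, e1]
    ring
  simp_rw [e]
  rw [integral_const_mul, h, finrank_euclideanSpace_fin]
  have h1 : ((Real.pi : ℂ) / (((2 * ε)⁻¹ : ℝ) : ℂ)) ^ ((d : ℂ) / 2)
      = ((2 * Real.pi * ε) ^ ((d : ℝ) / 2) : ℝ) := by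
    rw [Complex.ofReal_cpow (by positivity)]
    congr 1
    · push_cast
      field_simp
    · push_cast
      ring
  have h2 : (2 * Real.pi * ε) ^ (-(d : ℝ) / 2) * (2 * Real.pi * ε) ^ ((d : ℝ) / 2) = 1 := by
    rw [← Real.rpow_add (by positivity), neg_div, neg_add_cancel, Real.rpow_zero]
  rw [h1, mul_assoc, ← mul_assoc (Complex.ofReal _) (Complex.ofReal _), ← Complex.ofReal_mul, h2,
    Complex.ofReal_one, one_mul, mul_comm, Complex.ofReal_exp]
  congr 2
  push_cast
  rw [Complex.I_sq]
  field_simp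
  ring

lemma exp_neg_mul_norm_sq_integrable {μ : Measure 𝔼} (hμ : μ.HasTemperateGrowth) {ε : ℝ}
    (hε : 0 < ε) : Integrable (fun ξ : 𝔼 => Real.exp (-(ε / 2) * ‖ξ‖ ^ 2)) μ := by
  have h := ((gaussianSchwartz (b := ε / 2) (by positivity) (0 : 𝔼)).integrable (μ := μ)).norm
  refine h.congr (.of_forall fun ξ => ?_)
  simp only [gaussianSchwartz_apply, zero_sub, norm_neg]
  rw [Complex.norm_real, Real.norm_of_nonneg (Real.exp_pos _).le]

lemma sigmaFinite_of_hasTemperateGrowth {μ : Measure 𝔼} (hμ : μ.HasTemperateGrowth) :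
    SigmaFinite μ := by
  obtain ⟨n, hn⟩ := hμ.exists_integrable
  have h := isFiniteMeasure_withDensity_ofReal hn.2
  have hm : Measurable fun x : 𝔼 => ENNReal.ofReal ((1 + ‖x‖) ^ (-(n : ℝ))) := by fun_prop
  have hpos : ∀ x : 𝔼, ENNReal.ofReal ((1 + ‖x‖) ^ (-(n : ℝ))) ≠ 0 := fun x =>
    (ENNReal.ofReal_pos.2 (by positivity)).ne'
  rw [← withDensity_inv_same (μ := μ) hm (.of_forall hpos) (.of_forall fun _ => ENNReal.ofReal_ne_top)]
  exact SigmaFinite.withDensity_of_ne_top (.of_forall fun x => ENNReal.inv_ne_top.2 (hpos x))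

section FourierPair

variable {f : EuclideanSpace ℝ (Fin d) → ℝ} {μ : Measure (EuclideanSpace ℝ (Fin d))}

lemma IsFourierTransformOf.integrable_heatKernel_mul (hf : IsFourierTransformOf f μ) {ε : ℝ}
    (hε : 0 < ε) (x : 𝔼) : Integrable (fun y => heatKernel ε (x - y) * f y) := by
  have h := ((hf.integrable (gaussianSchwartz (b := (2 * ε)⁻¹) (by positivity) x)).const_mul
    ((2 * Real.pi * ε) ^ (-(d : ℝ) / 2) : ℝ)).re
  refine h.congr (.of_forall fun y => ?_)
  have : (heatKernel ε (x - y) * f y : ℝ) = ((heatKernel ε (x - y) : ℂ) * (f y : ℂ)).re := by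
    rw [← Complex.ofReal_mul, Complex.ofReal_re]
  beta_reduce
  rw [this, heatKernel_sub_eq ε hε, RCLike.re_to_complex]
  congr 1
  ring

/-- `p_ε * f` is the Fourier transform of the finite measure `exp (-ε‖ξ‖²/2) μ(dξ)`. -/
lemma IsFourierTransformOf.integral_heatKernel_mul (hf : IsFourierTransformOf f μ) {ε : ℝ}
    (hε : 0 < ε) (x : 𝔼) : ((∫ y, heatKernel ε (x - y) * f y : ℝ) : ℂ) =
      (((2 * Real.pi) ^ d)⁻¹ : ℝ) * ∫ ξ, (Real.exp (-(ε / 2) * ‖ξ‖ ^ 2) : ℂ) *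
        Complex.exp (-(Complex.I * (⟪ξ, x⟫ : ℝ))) ∂μ := by
  set c : ℂ := (((2 * Real.pi * ε) ^ (-(d : ℝ) / 2) : ℝ) : ℂ)
  set φ := gaussianSchwartz (b := (2 * ε)⁻¹) (by positivity) x
  have hφ : ∀ y, (heatKernel ε (x - y) : ℂ) = (c • φ) y := fun y => heatKernel_sub_eq ε hε x y
  have h := hf.fourier (c • φ)
  simp_rw [← hφ, integral_cexp_inner_mul_heatKernel ε hε] at h
  rw [← h, ← integral_complex_ofReal]
  congr 1 with y
  push_cast
  ring

lemma IsFourierTransformOf.locallyIntegrable (hf : IsFourierTransformOf f μ) :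
    LocallyIntegrable f := by
  have h := (hf.integrable_heatKernel_mul one_pos 0).locallyIntegrable
  have hpos : ∀ y : 𝔼, heatKernel 1 (0 - y) ≠ 0 := fun y => by
    unfold heatKernel
    positivity
  have hc : Continuous fun y : 𝔼 => (heatKernel 1 (0 - y))⁻¹ := by
    refine Continuous.inv₀ ?_ hpos
    unfold heatKernel
    fun_prop
  rw [locallyIntegrable_iff] at h ⊢
  intro k hk
  refine ((h k hk).continuousOn_mul hc.continuousOn hk).congr (.of_forall fun y => ?_)
  exact inv_mul_cancel_left₀ (hpos y) _

/-- A Fourier transform of the zero measure vanishes almost everywhere. -/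
lemma IsFourierTransformOf.ae_eq_zero (hf : IsFourierTransformOf f μ) (hμ : μ = 0) :
    ∀ᵐ x, f x = 0 := by
  refine ae_eq_zero_of_integral_contDiff_smul_eq_zero hf.locallyIntegrable fun g hg hgc => ?_
  have hg' : ContDiff ℝ ((⊤ : ℕ∞) : WithTop ℕ∞) (fun x => (g x : ℂ)) :=
    Complex.ofRealCLM.contDiff.comp hg
  have hgc' : HasCompactSupport (fun x => (g x : ℂ)) := hgc.comp_left (g := Complex.ofReal) rfl
  have h := hf.fourier (hgc'.toSchwartzMap hg')
  simp only [hμ, integral_zero_measure, mul_zero] at h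
  rw [← Complex.ofReal_inj, ← integral_complex_ofReal, Complex.ofReal_zero, ← h]
  congr 1 with x
  change ((g x * f x : ℝ) : ℂ) = f x * (g x : ℂ)
  rw [Complex.ofReal_mul, mul_comm]

end FourierPair

/-! ### Brownian motion: characteristic functions and continuous modifications -/

variable {Ω : Type*} [MeasurableSpace Ω] {P : Measure Ω}

/-- Joint characteristic function of a one-dimensional Brownian motion. -/
lemma integral_cexp_sum_brownianReal {B : ℝ≥0 → Ω → ℝ} (hB : IsPreBrownianReal B P) {n : ℕ}
    (c : Fin n → ℝ) (s : Fin n → ℝ≥0) :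
    ∫ ω, Complex.exp (Complex.I * (∑ j, c j * B (s j) ω : ℝ)) ∂P =
      (Real.exp (-(1 / 2) * ∑ j, ∑ k, min (s j) (s k) * (c j * c k)) : ℂ) := by
  have hG := hB.isGaussianProcess
  have : IsProbabilityMeasure P := hG.isProbabilityMeasure
  have hY : IsGaussianProcess (fun (_ : Unit) ω => ∑ j, c j * B (s j) ω) P := by
    classical
    refine hG.of_isGaussianProcess fun _ => ⟨Finset.univ.image s,
      ∑ j, c j • ContinuousLinearMap.proj (⟨s j, by simp⟩ : Finset.univ.image s), fun ω => ?_⟩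
    simp
  have hL := hY.hasGaussianLaw_eval ()
  have hm : ∀ j, MemLp (fun ω => c j * B (s j) ω) 2 P := fun j =>
    (hG.hasGaussianLaw_eval (s j)).memLp_two.const_mul (c j)
  have hmean : ∫ ω, ∑ j, c j * B (s j) ω ∂P = 0 := by
    rw [integral_finsetSum _ fun j _ => (hm j).integrable (by norm_num)]
    simp_rw [integral_const_mul, hB.integral_eval]
    simp
  have hvar : Var[fun ω => ∑ j, c j * B (s j) ω; P] =
      ∑ j, ∑ k, min (s j : ℝ) (s k) * (c j * c k) := by
    rw [← covariance_self hL.aemeasurable, covariance_fun_sum_fun_sum hm hm]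
    refine Finset.sum_congr rfl fun j _ => Finset.sum_congr rfl fun k _ => ?_
    rw [covariance_const_mul_left, covariance_const_mul_right, hB.covariance_fun_eval]
    push_cast
    ring
  have h := hL.charFun_map_eq 1
  rw [charFun_apply_real, integral_map hL.aemeasurable (by fun_prop)] at h
  simp only [Complex.ofReal_one, one_mul, RCLike.inner_apply, conj_trivial, mul_one] at h
  rw [hmean, hvar] at h
  simp_rw [mul_comm Complex.I]
  rw [h, Complex.ofReal_exp]
  push_cast
  congr 1
  ring

lemma sum_inner_eq_sum_coord {n : ℕ} (ξ x : Fin n → 𝔼) :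
    ∑ j, ⟪ξ j, x j⟫ = ∑ i, ∑ j, ξ j i * x j i := by
  rw [Finset.sum_comm]
  simp [PiLp.inner_apply, mul_comm]

lemma IsBrownian.aemeasurable {B : ℝ≥0 → Ω → 𝔼} (hB : IsBrownian B P) (u : ℝ≥0) :
    AEMeasurable (B u) P := by
  have h : AEMeasurable (fun ω i => B u ω i) P :=
    aemeasurable_pi_lambda _ fun i => (hB.coord i).aemeasurable u
  exact (MeasurableEquiv.toLp 2 (Fin d → ℝ)).measurable.comp_aemeasurable h

/-- Joint characteristic function of a `d`-dimensional Brownian motion. -/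
lemma IsBrownian.integral_cexp_sum [IsProbabilityMeasure P] {B : ℝ≥0 → Ω → 𝔼}
    (hB : IsBrownian B P) {n : ℕ} (ξ : Fin n → 𝔼) (s : Fin n → ℝ≥0) :
    ∫ ω, Complex.exp (Complex.I * (∑ j, ⟪ξ j, B (s j) ω⟫ : ℝ)) ∂P =
      (Real.exp (-(1 / 2) * ∑ j, ∑ k, min (s j) (s k) * ⟪ξ j, ξ k⟫) : ℂ) := by
  have hi : iIndepFun (fun (i : Fin d) (ω : Ω) =>
      Complex.exp (Complex.I * (∑ j, ξ j i * B (s j) ω i : ℝ))) P :=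
    hB.indep.comp (fun i (w : ℝ≥0 → ℝ) => Complex.exp (Complex.I * (∑ j, ξ j i * w (s j) : ℝ)))
      fun i => by fun_prop
  have h := hi.integral_fun_prod_eq_prod_integral fun i => by
    have : ∀ j, AEMeasurable (fun ω => B (s j) ω i) P := fun j => (hB.coord i).aemeasurable (s j)
    refine AEMeasurable.aestronglyMeasurable ?_
    fun_prop
  simp_rw [integral_cexp_sum_brownianReal (hB.coord _).toIsPreBrownianReal] at h
  simp_rw [sum_inner_eq_sum_coord]
  rw [← Complex.ofReal_prod, ← Real.exp_sum, ← Finset.mul_sum] at h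
  refine Eq.trans (integral_congr_ae (.of_forall fun ω => ?_)) (h.trans ?_)
  · beta_reduce
    rw [← Complex.exp_sum, Complex.ofReal_sum, Finset.mul_sum]
  · congr 3
    simp_rw [PiLp.inner_apply, Finset.mul_sum, RCLike.inner_apply, conj_trivial]
    rw [Finset.sum_comm]
    refine Finset.sum_congr rfl fun j _ => ?_
    rw [Finset.sum_comm]
    simp_rw [mul_comm]

/-- Joint characteristic function of the increments `B¹_r - B²_s`. -/
lemma integral_prod_cexp_inner [IsProbabilityMeasure P] {B₁ B₂ : ℝ≥0 → Ω → 𝔼}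
    (hB₁ : IsBrownian B₁ P) (hB₂ : IsBrownian B₂ P)
    (hB : IndepFun (fun ω u => B₁ u ω) (fun ω u => B₂ u ω) P) {n : ℕ} (ξ : Fin n → 𝔼)
    (r s : Fin n → ℝ) (hr : ∀ j, 0 ≤ r j) (hs : ∀ j, 0 ≤ s j) :
    ∫ ω, ∏ j, Complex.exp
        (-(Complex.I * (⟪ξ j, B₁ (r j).toNNReal ω - B₂ (s j).toNNReal ω⟫ : ℝ))) ∂P =
      (Real.exp (-(1 / 2) * ∑ j, ∑ k, sigma r s j k * ⟪ξ j, ξ k⟫) : ℂ) := by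
  have hm (ζ : Fin n → 𝔼) (u : Fin n → ℝ≥0) : Measurable
      (fun w : ℝ≥0 → 𝔼 => Complex.exp (Complex.I * (∑ j, ⟪ζ j, w (u j)⟫ : ℝ))) := by
    fun_prop
  have hi := hB.comp (hm (fun j => -ξ j) fun j => (r j).toNNReal) (hm ξ fun j => (s j).toNNReal)
  have hae {B : ℝ≥0 → Ω → 𝔼} (hB : IsBrownian B P) (ζ : Fin n → 𝔼) (u : Fin n → ℝ≥0) :
      AEStronglyMeasurable
        (fun ω => Complex.exp (Complex.I * (∑ j, ⟪ζ j, B (u j) ω⟫ : ℝ))) P := by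
    have := fun j => hB.aemeasurable (u j)
    refine AEMeasurable.aestronglyMeasurable ?_
    fun_prop
  have h := hi.integral_fun_mul_eq_mul_integral (hae hB₁ _ _) (hae hB₂ _ _)
  simp only [Function.comp_def] at h
  rw [hB₁.integral_cexp_sum, hB₂.integral_cexp_sum, ← Complex.ofReal_mul, ← Real.exp_add] at h
  refine Eq.trans (integral_congr_ae (.of_forall fun ω => ?_)) (h.trans ?_)
  · beta_reduce
    rw [← Complex.exp_sum, ← Complex.exp_add]
    congr 1
    push_cast
    rw [Finset.mul_sum, Finset.mul_sum, ← Finset.sum_add_distrib]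
    refine Finset.sum_congr rfl fun j _ => ?_
    rw [inner_sub_right, inner_neg_left]
    push_cast
    ring
  · rw [← mul_add, ← Finset.sum_add_distrib]
    simp_rw [← Finset.sum_add_distrib]
    congr 3
    refine Finset.sum_congr rfl fun j _ => Finset.sum_congr rfl fun k _ => ?_
    simp only [sigma, inner_neg_neg, NNReal.coe_min, Real.coe_toNNReal _ (hr _),
      Real.coe_toNNReal _ (hs _)]
    ring

/-- A Brownian motion has a modification all of whose paths are continuous, which agrees with it
on almost every path. -/
lemma IsBrownian.exists_continuous_modification {B : ℝ≥0 → Ω → 𝔼} (hB : IsBrownian B P) :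
    ∃ W : ℝ≥0 → Ω → 𝔼, (∀ ω, Continuous fun u => W u ω) ∧ (∀ u, Measurable (W u)) ∧
      ∀ᵐ ω ∂P, ∀ u, B u ω = W u ω := by
  classical
  obtain ⟨D, hDc, hDd⟩ := TopologicalSpace.exists_countable_dense ℝ≥0
  have hc : ∀ᵐ ω ∂P, Continuous fun u => B u ω := by
    have : ∀ᵐ ω ∂P, ∀ i, Continuous fun u => B u ω i := ae_all_iff.2 fun i => (hB.coord i).cont
    filter_upwards [this] with ω h
    exact (PiLp.continuous_toLp 2 _).comp (continuous_pi h)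
  have hq : ∀ᵐ ω ∂P, ∀ u ∈ D, B u ω = (hB.aemeasurable u).mk (B u) ω :=
    (ae_ball_iff hDc).2 fun u _ => (hB.aemeasurable u).ae_eq_mk
  -- `B` need not be measurable at each time: on a full measurable set `G` it is continuous and
  -- agrees with measurable versions at the times in `D`, and it is set to zero outside `G`.
  obtain ⟨G, hG, hGm, hGP⟩ := (hc.and hq).exists_measurable_mem
  refine ⟨fun u => G.indicator (B u), fun ω => ?_, fun u => ?_, ?_⟩
  · by_cases h : ω ∈ G
    · simpa [h] using (hGP ω h).1
    · simpa [h] using continuous_const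
  · have hD : ∀ v ∈ D, Measurable (G.indicator (B v)) := fun v hv => by
      have : G.indicator (B v) = G.indicator ((hB.aemeasurable v).mk (B v)) :=
        Set.indicator_congr fun ω hω => (hGP ω hω).2 v hv
      rw [this]
      exact (hB.aemeasurable v).measurable_mk.indicator hGm
    obtain ⟨v, hvD, hv⟩ := mem_closure_iff_seq_limit.1 (hDd u)
    refine measurable_of_tendsto_metrizable (fun n => hD (v n) (hvD n))
      (tendsto_pi_nhds.2 fun ω => ?_)
    by_cases h : ω ∈ G
    · simpa [h, Function.comp_def] using ((hGP ω h).1.tendsto u).comp hv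
    · simp [h]
  · filter_upwards [hG] with ω hω u
    simp [hω]

/-! ### Moments of oscillatory integrals -/

/-- Moments of oscillatory integrals: the expectation of a product of integrals
`∫ w_j(a) exp (-iθ(a, ω)) m(da)` is an integral over the product space, in which only the joint
characteristic function `K` of the phases enters. -/
lemma integral_prod_oscillatory [IsProbabilityMeasure P] {A : Type*} [MeasurableSpace A]
    {m : Measure A} [SigmaFinite m] {n : ℕ} {w : Fin n → A → ℝ} (hw : ∀ j, Integrable (w j) m)
    {θ : A → Ω → ℝ} (hθ : Measurable fun q : A × Ω => θ q.1 q.2) {K : (Fin n → A) → ℝ}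
    (hK : ∀ᵐ a ∂Measure.pi fun _ => m,
      ∫ ω, ∏ j, Complex.exp (-(Complex.I * (θ (a j) ω : ℝ))) ∂P = (K a : ℂ)) :
    ∫ ω, ∏ j, (∫ a, (w j a : ℂ) * Complex.exp (-(Complex.I * (θ a ω : ℝ))) ∂m) ∂P =
      ((∫ a, (∏ j, w j (a j)) * K a ∂Measure.pi fun _ => m : ℝ) : ℂ) := by
  have h1 : Integrable (fun a : Fin n → A => ∏ j, (w j (a j) : ℂ)) (Measure.pi fun _ => m) :=
    Integrable.fintype_prod (f := fun j a => (w j a : ℂ)) fun j => (hw j).ofReal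
  have h2 : Integrable (fun q : Ω × (Fin n → A) => (∏ j, (w j (q.2 j) : ℂ)) *
      ∏ j, Complex.exp (-(Complex.I * (θ (q.2 j) q.1 : ℝ)))) (P.prod (Measure.pi fun _ => m)) := by
    refine (h1.comp_snd P).mul_bdd (c := 1) ?_ (.of_forall fun q => ?_)
    · have : ∀ j, Measurable fun q : Ω × (Fin n → A) => θ (q.2 j) q.1 := fun j =>
        hθ.comp (by fun_prop : Measurable fun q : Ω × (Fin n → A) => (q.2 j, q.1))
      exact Measurable.aestronglyMeasurable (by fun_prop)
    · rw [norm_prod]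
      refine (Finset.prod_eq_one fun j _ => ?_).le
      rw [Complex.norm_exp]
      simp
  simp_rw [← integral_fintype_prod_eq_prod (𝕜 := ℂ), Finset.prod_mul_distrib]
  rw [integral_integral_swap h2, ← integral_complex_ofReal]
  refine integral_congr_ae ?_
  filter_upwards [hK] with a ha
  rw [integral_const_mul, ha]
  push_cast
  rfl

/-- Lebesgue measure on the square `[0,t]²`. -/
noncomputable abbrev squareMeasure (t : ℝ) : Measure (ℝ × ℝ) :=
  (volume.restrict (Set.Icc 0 t)).prod (volume.restrict (Set.Icc 0 t))

/-- The weight `η(r,s) exp (-ε‖ξ‖²/2)`, a function of `((r, s), ξ)`. -/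
noncomputable def weight (η : ℝ → ℝ → ℝ) (ε : ℝ) (a : (ℝ × ℝ) × 𝔼) : ℝ :=
  η a.1.1 a.1.2 * Real.exp (-(ε / 2) * ‖a.2‖ ^ 2)

/-- The kernel `exp (-½ ∑_{j,k} σ_{jk} ξ_j·ξ_k)`, a function of `((s_j, t_j), ξ_j)_j`. -/
noncomputable def gaussKernel {n : ℕ} (a : Fin n → (ℝ × ℝ) × 𝔼) : ℝ :=
  Real.exp (-(1 / 2) * ∑ j, ∑ k, sigma (fun j => (a j).1.1) (fun j => (a j).1.2) j k *
    ⟪(a j).2, (a k).2⟫)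

lemma measurable_gaussKernel (n : ℕ) :
    Measurable (gaussKernel (n := n) : (Fin n → (ℝ × ℝ) × 𝔼) → ℝ) := by
  unfold gaussKernel sigma
  fun_prop

variable {μ : Measure (EuclideanSpace ℝ (Fin d))} {t : ℝ} {η : ℝ → ℝ → ℝ}

lemma ae_squareMeasure_mem : ∀ᵐ q ∂squareMeasure t, q.1 ∈ Set.Icc 0 t ∧ q.2 ∈ Set.Icc 0 t := by
  rw [squareMeasure, Measure.prod_restrict]
  exact ae_restrict_mem (measurableSet_Icc.prod measurableSet_Icc)

lemma ae_pi_mem [SigmaFinite μ] (n : ℕ) :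
    ∀ᵐ a ∂Measure.pi fun _ : Fin n => (squareMeasure t).prod μ,
      ∀ j, (a j).1.1 ∈ Set.Icc 0 t ∧ (a j).1.2 ∈ Set.Icc 0 t :=
  ae_all_iff.2 fun j => (Measure.quasiMeasurePreserving_fst.comp
    (Measure.quasiMeasurePreserving_eval _ j)).ae ae_squareMeasure_mem

/-- `α_n` as an integral over the `n`-fold power of `[0,t]² × ℝ^d`. -/
lemma alpha_eq_lintegral [SigmaFinite μ]
    (hη : AEStronglyMeasurable (fun q : ℝ × ℝ => η q.1 q.2) (squareMeasure t))
    (hη0 : ∀ r ∈ Set.Icc 0 t, ∀ s ∈ Set.Icc 0 t, 0 ≤ η r s) (n : ℕ) :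
    alpha μ t η n = ENNReal.ofReal ((2 * Real.pi) ^ (n * d))⁻¹ *
      ∫⁻ a, ENNReal.ofReal ((∏ j, η (a j).1.1 (a j).1.2) * gaussKernel a)
        ∂Measure.pi fun _ : Fin n => (squareMeasure t).prod μ := by
  have e1 := (measurePreserving_arrowProdEquivProdArrow (ℝ × ℝ) 𝔼 (Fin n)
    (fun _ => squareMeasure t) (fun _ => μ)).symm
  have e2 := (measurePreserving_arrowProdEquivProdArrow ℝ ℝ (Fin n)
    (fun _ => volume.restrict (Set.Icc 0 t)) (fun _ => volume.restrict (Set.Icc 0 t))).symm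
  have hprod : AEMeasurable (fun q : Fin n → ℝ × ℝ => ∏ j, η (q j).1 (q j).2)
      (Measure.pi fun _ => squareMeasure t) :=
    Finset.aemeasurable_fun_prod _ fun j _ =>
      (hη.comp_quasiMeasurePreserving (Measure.quasiMeasurePreserving_eval _ j)).aemeasurable
  have hmeas : AEMeasurable (fun x : (Fin n → ℝ × ℝ) × (Fin n → 𝔼) =>
      ENNReal.ofReal ((∏ j, η (x.1 j).1 (x.1 j).2) * gaussKernel fun j => (x.1 j, x.2 j)))
      ((Measure.pi fun _ => squareMeasure t).prod (Measure.pi fun _ => μ)) := by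
    refine ((hprod.comp_quasiMeasurePreserving Measure.quasiMeasurePreserving_fst).mul
      (Measurable.aemeasurable ?_)).ennreal_ofReal
    exact (measurable_gaussKernel n).comp (by fun_prop)
  have hnn : ∀ᵐ q ∂Measure.pi fun _ : Fin n => squareMeasure t,
      0 ≤ ∏ j, η (q j).1 (q j).2 := by
    have : ∀ᵐ q ∂Measure.pi fun _ : Fin n => squareMeasure t,
        ∀ j, (q j).1 ∈ Set.Icc 0 t ∧ (q j).2 ∈ Set.Icc 0 t := ae_all_iff.2 fun j =>
      (Measure.quasiMeasurePreserving_eval (fun _ : Fin n => squareMeasure t) j).ae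
        ae_squareMeasure_mem
    filter_upwards [this] with q hq
    exact Finset.prod_nonneg fun j _ => hη0 _ (hq j).1 _ (hq j).2
  rw [← e1.lintegral_comp_emb (MeasurableEquiv.measurableEmbedding _)]
  change _ = _ * ∫⁻ x : (Fin n → ℝ × ℝ) × (Fin n → 𝔼),
      ENNReal.ofReal ((∏ j, η (x.1 j).1 (x.1 j).2) * gaussKernel fun j => (x.1 j, x.2 j)) ∂_
  rw [lintegral_prod _ hmeas, ← lintegral_const_mul' _ _ ENNReal.ofReal_ne_top, alpha,
    Measure.volume_eq_prod, ← Measure.prod_restrict, ← Set.pi_univ_Icc, volume_pi]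
  simp only [Pi.zero_apply]
  rw [Measure.restrict_pi_pi,
    ← (e2.symm _).lintegral_comp_emb (MeasurableEquiv.measurableEmbedding _)]
  refine lintegral_congr_ae ?_
  filter_upwards [hnn] with q hq
  simp_rw [ENNReal.ofReal_mul hq]
  rw [lintegral_const_mul' _ _ ENNReal.ofReal_ne_top, mul_left_comm]
  rfl

/-! ### Bounds and limits of the spectral integrals -/

lemma sigma_le {n : ℕ} {s r : Fin n → ℝ} (hs : ∀ j, s j ∈ Set.Icc 0 t)
    (hr : ∀ j, r j ∈ Set.Icc 0 t) (j k : Fin n) : |sigma s r j k| ≤ 2 * t := by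
  have h1 : 0 ≤ min (s j) (s k) := le_min (hs j).1 (hs k).1
  have h2 : 0 ≤ min (r j) (r k) := le_min (hr j).1 (hr k).1
  have h3 : min (s j) (s k) ≤ t := (min_le_left _ _).trans (hs j).2
  have h4 : min (r j) (r k) ≤ t := (min_le_left _ _).trans (hr j).2
  rw [sigma, abs_of_nonneg (by linarith)]
  linarith

/-- On `[0,t]²ⁿ` the kernel is bounded below by a positive function of the frequencies alone. -/
lemma le_gaussKernel {n : ℕ} {a : Fin n → (ℝ × ℝ) × 𝔼}
    (ha : ∀ j, (a j).1.1 ∈ Set.Icc 0 t ∧ (a j).1.2 ∈ Set.Icc 0 t) :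
    ∏ j, Real.exp (-(n * t) * ‖(a j).2‖ ^ 2) ≤ gaussKernel a := by
  rw [← Real.exp_sum, gaussKernel, Real.exp_le_exp, ← Finset.mul_sum]
  have h : ∑ j, ∑ k, sigma (fun j => (a j).1.1) (fun j => (a j).1.2) j k * ⟪(a j).2, (a k).2⟫ ≤
      ∑ j : Fin n, ∑ k : Fin n, t * (‖(a j).2‖ ^ 2 + ‖(a k).2‖ ^ 2) := by
    refine Finset.sum_le_sum fun j _ => Finset.sum_le_sum fun k _ => (le_abs_self _).trans ?_
    rw [abs_mul]
    have ht : 0 ≤ t := (ha j).1.1.trans (ha j).1.2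
    calc _ ≤ (2 * t) * (‖(a j).2‖ * ‖(a k).2‖) :=
          mul_le_mul (sigma_le (fun j => (ha j).1) (fun j => (ha j).2) j k)
            (abs_real_inner_le_norm _ _) (abs_nonneg _) (by positivity)
      _ ≤ _ := by nlinarith [mul_nonneg ht (sq_nonneg (‖(a j).2‖ - ‖(a k).2‖))]
  have e : ∑ j : Fin n, ∑ k : Fin n, t * (‖(a j).2‖ ^ 2 + ‖(a k).2‖ ^ 2) =
      2 * (n * t * ∑ j : Fin n, ‖(a j).2‖ ^ 2) := by
    simp_rw [← Finset.mul_sum, Finset.sum_add_distrib, Finset.sum_const, Finset.card_univ,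
      Fintype.card_fin, ← Finset.smul_sum]
    simp only [nsmul_eq_mul]
    ring
  linarith

/-- If `α₂ < ∞` then `η` is integrable on `[0,t]²`, unless `μ = 0`. -/
lemma integrable_of_alpha_two_lt_top [SigmaFinite μ]
    (hη : AEStronglyMeasurable (fun q : ℝ × ℝ => η q.1 q.2) (squareMeasure t))
    (hη0 : ∀ r ∈ Set.Icc 0 t, ∀ s ∈ Set.Icc 0 t, 0 ≤ η r s)
    (hα : alpha μ t η 2 < ⊤) (hμ : μ ≠ 0) :
    Integrable (fun q : ℝ × ℝ => η q.1 q.2) (squareMeasure t) := by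
  rw [alpha_eq_lintegral hη hη0] at hα
  have hα' := ENNReal.lt_top_of_mul_ne_top_right hα.ne
    (ENNReal.ofReal_pos.2 (by positivity)).ne'
  -- The lower bound on the kernel factorizes, so `α₂` dominates a multiple of `(∫ η)²`.
  set g : (ℝ × ℝ) × 𝔼 → ℝ≥0∞ := fun a =>
    ENNReal.ofReal (η a.1.1 a.1.2) * ENNReal.ofReal (Real.exp (-(2 * t) * ‖a.2‖ ^ 2)) with hg
  have hηm : AEMeasurable (fun q : ℝ × ℝ => ENNReal.ofReal (η q.1 q.2)) (squareMeasure t) :=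
    hη.aemeasurable.ennreal_ofReal
  have hem : Measurable fun ξ : 𝔼 => ENNReal.ofReal (Real.exp (-(2 * t) * ‖ξ‖ ^ 2)) := by fun_prop
  have hgm : AEMeasurable g ((squareMeasure t).prod μ) :=
    (hηm.comp_quasiMeasurePreserving Measure.quasiMeasurePreserving_fst).mul
      (hem.comp measurable_snd).aemeasurable
  have h1 : ∫⁻ a, g (a 0) * g (a 1) ∂(Measure.pi fun _ : Fin 2 => (squareMeasure t).prod μ) < ⊤ := by
    refine (lintegral_mono_ae ?_).trans_lt hα'
    filter_upwards [ae_pi_mem 2] with a ha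
    have hle := le_gaussKernel ha
    have hη2 : 0 ≤ ∏ j, η (a j).1.1 (a j).1.2 :=
      Finset.prod_nonneg fun j _ => hη0 _ (ha j).1 _ (ha j).2
    have e : g (a 0) * g (a 1) = ENNReal.ofReal ((∏ j, η (a j).1.1 (a j).1.2) *
        ∏ j, Real.exp (-((2 : ℕ) * t) * ‖(a j).2‖ ^ 2)) := by
      simp only [hg, Fin.prod_univ_two, Nat.cast_ofNat]
      have p0 := hη0 _ (ha 0).1 _ (ha 0).2
      have p1 := hη0 _ (ha 1).1 _ (ha 1).2
      rw [ENNReal.ofReal_mul (mul_nonneg p0 p1), ENNReal.ofReal_mul p0,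
        ENNReal.ofReal_mul (Real.exp_pos _).le]
      ring
    rw [e]
    gcongr
  have e2 := (measurePreserving_finTwoArrow ((squareMeasure t).prod μ)).symm
  rw [← e2.lintegral_comp_emb (MeasurableEquiv.measurableEmbedding _)] at h1
  change ∫⁻ x : ((ℝ × ℝ) × 𝔼) × ((ℝ × ℝ) × 𝔼), g x.1 * g x.2 ∂_ < ⊤ at h1
  rw [lintegral_prod_mul hgm hgm] at h1
  have h2 : ∫⁻ a, g a ∂(squareMeasure t).prod μ < ⊤ := by
    by_contra! h
    rw [top_le_iff.1 h] at h1
    simp at h1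
  rw [lintegral_prod_mul hηm hem.aemeasurable] at h2
  refine ⟨hη, ?_⟩
  rw [hasFiniteIntegral_iff_ofReal]
  · refine ENNReal.lt_top_of_mul_ne_top_left h2.ne fun h0 => hμ ?_
    rw [lintegral_eq_zero_iff hem] at h0
    rw [← ae_eq_bot, ← eventually_false_iff_eq_bot]
    filter_upwards [h0] with ξ hξ
    exact (ENNReal.ofReal_pos.2 (Real.exp_pos _)).ne' hξ
  · filter_upwards [ae_squareMeasure_mem] with q hq
    exact hη0 _ hq.1 _ hq.2

lemma integrable_weight (hμ : μ.HasTemperateGrowth)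
    (hη : Integrable (fun q : ℝ × ℝ => η q.1 q.2) (squareMeasure t) ∨ μ = 0) {ε : ℝ} (hε : 0 < ε) :
    Integrable (weight η ε) ((squareMeasure t).prod μ) := by
  rcases hη with hη | rfl
  · have := sigmaFinite_of_hasTemperateGrowth hμ
    exact hη.mul_prod (exp_neg_mul_norm_sq_integrable hμ hε)
  · simp

/-- The integrand of `α_n` is integrable; it dominates all the regularized ones. -/
lemma integrable_prod_mul_gaussKernel [SigmaFinite μ]
    (hη : AEStronglyMeasurable (fun q : ℝ × ℝ => η q.1 q.2) (squareMeasure t))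
    (hη0 : ∀ r ∈ Set.Icc 0 t, ∀ s ∈ Set.Icc 0 t, 0 ≤ η r s) {n : ℕ}
    (hα : alpha μ t η n < ⊤) :
    Integrable (fun a => (∏ j, η (a j).1.1 (a j).1.2) * gaussKernel a)
      (Measure.pi fun _ : Fin n => (squareMeasure t).prod μ) := by
  rw [alpha_eq_lintegral hη hη0] at hα
  refine ⟨?_, ?_⟩
  · refine AEMeasurable.aestronglyMeasurable ?_
    refine AEMeasurable.mul (Finset.aemeasurable_fun_prod _ fun j _ => ?_)
      (measurable_gaussKernel n).aemeasurable
    exact (hη.comp_quasiMeasurePreserving (Measure.quasiMeasurePreserving_fst.comp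
      (Measure.quasiMeasurePreserving_eval (fun _ => (squareMeasure t).prod μ) j))).aemeasurable
  · rw [hasFiniteIntegral_iff_ofReal]
    · refine ENNReal.lt_top_of_mul_ne_top_right hα.ne ?_
      exact (ENNReal.ofReal_pos.2 (by positivity)).ne'
    · filter_upwards [ae_pi_mem n] with a ha
      exact mul_nonneg (Finset.prod_nonneg fun j _ => hη0 _ (ha j).1 _ (ha j).2)
        (Real.exp_pos _).le

/-- `(2π)^{-nd} ∫ ∏_j η(s_j,t_j) exp (-ε_j‖ξ_j‖²/2) K` tends to `α_n` as all `ε_j ↓ 0`. -/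
lemma tendsto_integral_prod_weight [SigmaFinite μ]
    (hη : AEStronglyMeasurable (fun q : ℝ × ℝ => η q.1 q.2) (squareMeasure t))
    (hη0 : ∀ r ∈ Set.Icc 0 t, ∀ s ∈ Set.Icc 0 t, 0 ≤ η r s) {n : ℕ}
    (hα : alpha μ t η n < ⊤) {ι : Type*} {l : Filter ι} [l.IsCountablyGenerated]
    {e : ι → Fin n → ℝ} (he : ∀ᶠ i in l, ∀ j, 0 < e i j)
    (hl : ∀ j, Tendsto (fun i => e i j) l (𝓝 0)) :
    Tendsto (fun i => ((2 * Real.pi) ^ (n * d))⁻¹ *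
      ∫ a, (∏ j, weight η (e i j) (a j)) * gaussKernel a
        ∂Measure.pi fun _ : Fin n => (squareMeasure t).prod μ) l (𝓝 (alpha μ t η n).toReal) := by
  have hJ := integrable_prod_mul_gaussKernel hη hη0 hα
  have hnn : ∀ᵐ a ∂Measure.pi fun _ : Fin n => (squareMeasure t).prod μ,
      0 ≤ (∏ j, η (a j).1.1 (a j).1.2) * gaussKernel a := by
    filter_upwards [ae_pi_mem n] with a ha
    exact mul_nonneg (Finset.prod_nonneg fun j _ => hη0 _ (ha j).1 _ (ha j).2)
        (Real.exp_pos _).le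
  have hw : ∀ i, (fun a : Fin n → (ℝ × ℝ) × 𝔼 =>
      (∏ j, weight η (e i j) (a j)) * gaussKernel a) = fun a =>
      ((∏ j, η (a j).1.1 (a j).1.2) * gaussKernel a) *
        ∏ j, Real.exp (-(e i j / 2) * ‖(a j).2‖ ^ 2) := fun i => by
    ext a
    simp only [weight, Finset.prod_mul_distrib]
    ring
  rw [alpha_eq_lintegral hη hη0, ENNReal.toReal_mul, ENNReal.toReal_ofReal (by positivity),
    ← integral_eq_lintegral_of_nonneg_ae hnn hJ.1]
  refine Tendsto.const_mul _ (tendsto_integral_filter_of_dominated_convergence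
    (fun a => (∏ j, η (a j).1.1 (a j).1.2) * gaussKernel a) (.of_forall fun i => ?_) ?_ hJ ?_)
  · rw [hw]
    exact hJ.1.mul (Measurable.aestronglyMeasurable (by fun_prop))
  · filter_upwards [he] with i hi
    filter_upwards [hnn] with a ha
    rw [congrFun (hw i) a, norm_mul, Real.norm_of_nonneg ha]
    refine mul_le_of_le_one_right ha ?_
    rw [norm_prod]
    refine Finset.prod_le_one (fun _ _ => norm_nonneg _) fun j _ => ?_
    rw [Real.norm_of_nonneg (Real.exp_pos _).le, Real.exp_le_one_iff]
    have := hi j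
    have : 0 ≤ e i j / 2 * ‖(a j).2‖ ^ 2 := by positivity
    linarith
  · refine .of_forall fun a => ?_
    simp_rw [fun i => congrFun (hw i) a]
    have : ∀ j, Tendsto (fun i => Real.exp (-(e i j / 2) * ‖(a j).2‖ ^ 2)) l (𝓝 1) := fun j => by
      have h := (((hl j).div_const 2).neg.mul_const (‖(a j).2‖ ^ 2)).rexp
      simpa using h
    simpa using (tendsto_finsetProd Finset.univ fun j _ => this j).const_mul
      ((∏ j, η (a j).1.1 (a j).1.2) * gaussKernel a)

variable {B₁ B₂ W₁ W₂ : ℝ≥0 → Ω → EuclideanSpace ℝ (Fin d)}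
  {f : EuclideanSpace ℝ (Fin d) → ℝ}

/-- The Fourier phase `ξ · (W¹_r - W²_s)` at the point `((r, s), ξ)`. -/
noncomputable def phase (W₁ W₂ : ℝ≥0 → Ω → 𝔼) (a : (ℝ × ℝ) × 𝔼) (ω : Ω) : ℝ :=
  ⟪a.2, W₁ a.1.1.toNNReal ω - W₂ a.1.2.toNNReal ω⟫

lemma measurable_uncurry_path {W : ℝ≥0 → Ω → 𝔼} (hc : ∀ ω, Continuous fun u => W u ω)
    (hm : ∀ u, Measurable (W u)) : Measurable (Function.uncurry W) :=
  measurable_uncurry_of_continuous_of_measurable (u := W) hc hm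

lemma measurable_phase (hc₁ : ∀ ω, Continuous fun u => W₁ u ω) (hm₁ : ∀ u, Measurable (W₁ u))
    (hc₂ : ∀ ω, Continuous fun u => W₂ u ω) (hm₂ : ∀ u, Measurable (W₂ u)) :
    Measurable fun q : ((ℝ × ℝ) × 𝔼) × Ω => phase W₁ W₂ q.1 q.2 := by
  unfold phase
  have h1 := (measurable_uncurry_path hc₁ hm₁).comp (by fun_prop : Measurable fun
    q : ((ℝ × ℝ) × 𝔼) × Ω => (q.1.1.1.toNNReal, q.2))
  have h2 := (measurable_uncurry_path hc₂ hm₂).comp (by fun_prop : Measurable fun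
    q : ((ℝ × ℝ) × 𝔼) × Ω => (q.1.1.2.toNNReal, q.2))
  exact (by fun_prop : Measurable fun q : ((ℝ × ℝ) × 𝔼) × Ω => q.1.2).inner (h1.sub h2)

/-- The spectral representation of the approximate local time, along continuous paths. -/
lemma approxLocalTime_eq {Ω : Type*} {W₁ W₂ : ℝ≥0 → Ω → 𝔼} (hf : IsFourierTransformOf f μ)
    (hη : Integrable (fun q : ℝ × ℝ => η q.1 q.2) (squareMeasure t) ∨ μ = 0) {ε : ℝ} (hε : 0 < ε)
    {ω : Ω} (h₁ : Continuous fun u => W₁ u ω) (h₂ : Continuous fun u => W₂ u ω) :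
    (approxLocalTime W₁ W₂ f t η ε ω : ℂ) = (((2 * Real.pi) ^ d)⁻¹ : ℝ) *
      ∫ a, (weight η ε a : ℂ) * Complex.exp (-(Complex.I * (phase W₁ W₂ a ω : ℝ)))
        ∂(squareMeasure t).prod μ := by
  have := sigmaFinite_of_hasTemperateGrowth hf.temperate
  have hint : Integrable (fun a => (weight η ε a : ℂ) *
      Complex.exp (-(Complex.I * (phase W₁ W₂ a ω : ℝ)))) ((squareMeasure t).prod μ) := by
    refine (integrable_weight hf.temperate hη hε).ofReal.mul_bdd (c := 1) ?_ (.of_forall fun a => ?_)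
    · unfold phase
      refine Continuous.aestronglyMeasurable ?_
      have h1 : Continuous fun a : (ℝ × ℝ) × 𝔼 => W₁ a.1.1.toNNReal ω :=
        h₁.comp (by fun_prop)
      have h2 : Continuous fun a : (ℝ × ℝ) × 𝔼 => W₂ a.1.2.toNNReal ω :=
        h₂.comp (by fun_prop)
      fun_prop
    · rw [Complex.norm_exp]
      simp
  rw [integral_prod _ hint, integral_prod_symm _ hint.integral_prod_left, ← integral_const_mul,
    approxLocalTime, ← integral_complex_ofReal]
  refine integral_congr_ae (.of_forall fun s => ?_)
  beta_reduce
  rw [← integral_const_mul, ← integral_complex_ofReal]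
  refine integral_congr_ae (.of_forall fun r => ?_)
  simp only [integrand, weight, phase, mul_assoc]
  rw [integral_const_mul, Complex.ofReal_mul, hf.integral_heatKernel_mul hε]
  simp_rw [Complex.ofReal_mul, mul_assoc]
  rw [integral_const_mul, mul_left_comm]

/-! ### The approximate local times as random variables -/

/-- Mixed moments of the approximate local times. -/
lemma integral_prod_approxLocalTime [IsProbabilityMeasure P] (hB₁ : IsBrownian B₁ P)
    (hB₂ : IsBrownian B₂ P) (hB : IndepFun (fun ω u => B₁ u ω) (fun ω u => B₂ u ω) P)
    (hf : IsFourierTransformOf f μ)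
    (hη : Integrable (fun q : ℝ × ℝ => η q.1 q.2) (squareMeasure t) ∨ μ = 0)
    {n : ℕ} {e : Fin n → ℝ} (he : ∀ j, 0 < e j) :
    ∫ ω, ∏ j, approxLocalTime B₁ B₂ f t η (e j) ω ∂P = ((2 * Real.pi) ^ (n * d))⁻¹ *
      ∫ a, (∏ j, weight η (e j) (a j)) * gaussKernel a
        ∂Measure.pi fun _ : Fin n => (squareMeasure t).prod μ := by
  have := sigmaFinite_of_hasTemperateGrowth hf.temperate
  -- Continuous modifications are jointly measurable in time and `ω`, as Fubini requires.
  obtain ⟨W₁, hc₁, hm₁, hW₁⟩ := hB₁.exists_continuous_modification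
  obtain ⟨W₂, hc₂, hm₂, hW₂⟩ := hB₂.exists_continuous_modification
  have hK : ∀ᵐ a ∂Measure.pi fun _ : Fin n => (squareMeasure t).prod μ,
      ∫ ω, ∏ j, Complex.exp (-(Complex.I * (phase W₁ W₂ (a j) ω : ℝ))) ∂P =
        (gaussKernel a : ℂ) := by
    filter_upwards [ae_pi_mem n] with a ha
    rw [gaussKernel, ← integral_prod_cexp_inner hB₁ hB₂ hB (fun j => (a j).2) _ _
      (fun j => (ha j).1.1) (fun j => (ha j).2.1)]
    refine integral_congr_ae ?_
    filter_upwards [hW₁, hW₂] with ω h₁ h₂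
    simp only [phase, h₁, h₂]
  have h := integral_prod_oscillatory (fun j => integrable_weight hf.temperate hη (he j))
    (measurable_phase hc₁ hm₁ hc₂ hm₂) hK
  rw [← Complex.ofReal_inj, Complex.ofReal_mul, ← h, ← integral_complex_ofReal,
    ← integral_const_mul]
  refine integral_congr_ae ?_
  filter_upwards [hW₁, hW₂] with ω h₁ h₂
  have hBW : ∀ ε, approxLocalTime B₁ B₂ f t η ε ω = approxLocalTime W₁ W₂ f t η ε ω := fun ε => by
    simp only [approxLocalTime, integrand, h₁, h₂]
  simp_rw [hBW]
  push_cast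
  simp_rw [fun j => approxLocalTime_eq hf hη (he j) (hc₁ ω) (hc₂ ω), Finset.prod_mul_distrib,
    Finset.prod_const, Finset.card_univ, Fintype.card_fin]
  push_cast
  rw [inv_pow, ← pow_mul, mul_comm d n]

/-- Each approximate local time is an almost surely bounded random variable. -/
lemma memLp_approxLocalTime [IsProbabilityMeasure P] (hB₁ : IsBrownian B₁ P)
    (hB₂ : IsBrownian B₂ P) (hf : IsFourierTransformOf f μ)
    (hη : Integrable (fun q : ℝ × ℝ => η q.1 q.2) (squareMeasure t) ∨ μ = 0) {ε : ℝ} (hε : 0 < ε)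
    (p : ℝ≥0∞) : MemLp (approxLocalTime B₁ B₂ f t η ε) p P := by
  have := sigmaFinite_of_hasTemperateGrowth hf.temperate
  obtain ⟨W₁, hc₁, hm₁, hW₁⟩ := hB₁.exists_continuous_modification
  obtain ⟨W₂, hc₂, hm₂, hW₂⟩ := hB₂.exists_continuous_modification
  set F : Ω → ℂ := fun ω => (((2 * Real.pi) ^ d)⁻¹ : ℝ) *
      ∫ a, (weight η ε a : ℂ) * Complex.exp (-(Complex.I * (phase W₁ W₂ a ω : ℝ)))
        ∂(squareMeasure t).prod μ with hF
  have hw := integrable_weight hf.temperate hη hε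
  have hFm : AEStronglyMeasurable F P := by
    refine AEStronglyMeasurable.const_mul ?_ _
    refine AEStronglyMeasurable.integral_prod_right' (f := fun q : Ω × ((ℝ × ℝ) × 𝔼) =>
      (weight η ε q.2 : ℂ) * Complex.exp (-(Complex.I * (phase W₁ W₂ q.2 q.1 : ℝ)))) ?_
    have h1 := (measurable_phase hc₁ hm₁ hc₂ hm₂).comp measurable_swap
    refine (hw.ofReal (𝕜 := ℂ)).1.comp_snd.mul (Measurable.aestronglyMeasurable ?_)
    simp only [Function.comp_def, Prod.fst_swap, Prod.snd_swap] at h1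
    fun_prop
  have hFb : ∀ ω, ‖F ω‖ ≤ ((2 * Real.pi) ^ d)⁻¹ * ∫ a, ‖weight η ε a‖ ∂(squareMeasure t).prod μ := by
    intro ω
    rw [hF, norm_mul, Complex.norm_real, Real.norm_of_nonneg (by positivity)]
    gcongr
    refine (norm_integral_le_integral_norm _).trans_eq (integral_congr_ae (.of_forall fun a => ?_))
    simp [Complex.norm_exp]
  have hlim : approxLocalTime B₁ B₂ f t η ε =ᵐ[P] fun ω => (F ω).re := by
    filter_upwards [hW₁, hW₂] with ω h₁ h₂
    have e : (approxLocalTime W₁ W₂ f t η ε ω : ℂ) = F ω :=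
      approxLocalTime_eq hf hη hε (hc₁ ω) (hc₂ ω)
    rw [← e, Complex.ofReal_re]
    simp only [approxLocalTime, integrand, h₁, h₂]
  refine (MemLp.of_bound (C := ((2 * Real.pi) ^ d)⁻¹ *
    ∫ a, ‖weight η ε a‖ ∂(squareMeasure t).prod μ) hFm ?_).re.ae_eq hlim.symm
  exact .of_forall hFb

/-- Translates of the heat kernel by bounded vectors are dominated by a wider heat kernel. -/
lemma exists_heatKernel_sub_le {ε : ℝ} (hε : 0 < ε) (R : ℝ) :
    ∃ C : ℝ, ∀ z y : 𝔼, ‖z‖ ≤ R → heatKernel ε (z - y) ≤ C * heatKernel (2 * ε) (0 - y) := by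
  set c := fun ε : ℝ => (2 * Real.pi * ε) ^ (-(d : ℝ) / 2) with hc
  have hcpos : ∀ ε, 0 < ε → 0 < c ε := fun ε h => by
    rw [hc]
    positivity
  refine ⟨c ε * Real.exp (R ^ 2 / (2 * ε)) / c (2 * ε), fun z y hz => ?_⟩
  have h2 := hcpos (2 * ε) (by positivity)
  have h1 := hcpos ε hε
  have e : c ε * Real.exp (R ^ 2 / (2 * ε)) / c (2 * ε) * heatKernel (2 * ε) (0 - y) =
      c ε * Real.exp (R ^ 2 / (2 * ε) + -‖y‖ ^ 2 / (2 * (2 * ε))) := by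
    rw [Real.exp_add, heatKernel, zero_sub, norm_neg]
    change _ * (c (2 * ε) * _) = _
    field_simp
  rw [e, heatKernel]
  change c ε * _ ≤ _
  gcongr
  have h := neg_norm_sub_sq_le z y
  have hz2 : ‖z‖ ^ 2 ≤ R ^ 2 := by gcongr
  have e2 : R ^ 2 / (2 * ε) + -‖y‖ ^ 2 / (2 * (2 * ε)) = (R ^ 2 - ‖y‖ ^ 2 / 2) / (2 * ε) := by
    field_simp
    ring
  rw [e2]
  gcongr
  linarith

/-- The triple integral defining the approximate local time converges absolutely. -/
lemma ae_integrable_integrand (hB₁ : IsBrownian B₁ P) (hB₂ : IsBrownian B₂ P)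
    (hf : IsFourierTransformOf f μ)
    (hη : Integrable (fun q : ℝ × ℝ => η q.1 q.2) (squareMeasure t) ∨ μ = 0) {ε : ℝ}
    (hε : 0 < ε) : ∀ᵐ ω ∂P, Integrable (fun q : ℝ × ℝ × 𝔼 =>
      integrand B₁ B₂ f η ε ω q.1 q.2.1 q.2.2)
      ((volume.restrict (Set.Icc 0 t)).prod ((volume.restrict (Set.Icc 0 t)).prod volume)) := by
  obtain ⟨W₁, hc₁, hm₁, hW₁⟩ := hB₁.exists_continuous_modification
  obtain ⟨W₂, hc₂, hm₂, hW₂⟩ := hB₂.exists_continuous_modification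
  filter_upwards [hW₁, hW₂] with ω h₁ h₂
  rw [← (measurePreserving_prodAssoc (volume.restrict (Set.Icc (0 : ℝ) t))
    (volume.restrict (Set.Icc (0 : ℝ) t)) (volume : Measure 𝔼)).integrable_comp_emb
    (MeasurableEquiv.measurableEmbedding _)]
  change Integrable (fun q : (ℝ × ℝ) × 𝔼 => integrand B₁ B₂ f η ε ω q.1.1 q.1.2 q.2)
    ((squareMeasure t).prod volume)
  simp only [integrand, h₁, h₂]
  rcases hη with hη | hμ
  · have hZ : Continuous fun q : ℝ × ℝ => W₁ q.1.toNNReal ω - W₂ q.2.toNNReal ω :=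
      ((hc₁ ω).comp (by fun_prop)).sub ((hc₂ ω).comp (by fun_prop))
    obtain ⟨R, hR⟩ := (isCompact_Icc.prod isCompact_Icc :
      IsCompact (Set.Icc 0 t ×ˢ Set.Icc 0 t)).exists_bound_of_continuousOn hZ.continuousOn
    obtain ⟨C, hC⟩ := exists_heatKernel_sub_le (d := d) hε R
    refine ((hη.mul_prod (hf.integrable_heatKernel_mul (ε := 2 * ε) (by positivity) 0)).norm.const_mul
      C).mono' ?_ ?_
    · have hk : Continuous fun q : (ℝ × ℝ) × 𝔼 =>
          heatKernel ε (W₁ q.1.1.toNNReal ω - W₂ q.1.2.toNNReal ω - q.2) := by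
        have hh : Continuous (heatKernel ε : 𝔼 → ℝ) := by
          unfold heatKernel
          fun_prop
        exact hh.comp ((hZ.comp continuous_fst).sub continuous_snd)
      exact (hη.1.comp_fst.mul hk.aestronglyMeasurable).mul
        hf.locallyIntegrable.aestronglyMeasurable.comp_snd
    · filter_upwards [Measure.quasiMeasurePreserving_fst.ae (ae_squareMeasure_mem (t := t))]
        with q hq
      have h0 : ∀ (δ : ℝ) (x : 𝔼), 0 < δ → 0 ≤ heatKernel δ x := fun δ x hδ => by
        unfold heatKernel
        positivity
      have hk := hC _ q.2 (hR q.1 ⟨hq.1, hq.2⟩)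
      simp only [norm_mul]
      rw [Real.norm_of_nonneg (h0 ε _ hε), Real.norm_of_nonneg (h0 (2 * ε) _ (by positivity))]
      calc _ ≤ ‖η q.1.1 q.1.2‖ * (C * heatKernel (2 * ε) (0 - q.2)) * ‖f q.2‖ := by gcongr
        _ = _ := by ring
  · have h0 : ∀ᵐ q ∂(squareMeasure t).prod (volume : Measure 𝔼), f q.2 = 0 :=
      Measure.quasiMeasurePreserving_snd.ae (hf.ae_eq_zero hμ)
    refine (integrable_zero _ _ _).congr ?_
    filter_upwards [h0] with q hq
    simp [hq]

/-! ### Convergence in Lebesgue spaces -/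

/-- Since `‖u_i - u_j‖² = ⟪u_i, u_i⟫ - 2⟪u_i, u_j⟫ + ⟪u_j, u_j⟫`, convergence of the inner products
along the product filter makes a family Cauchy. -/
lemma cauchy_map_of_tendsto_inner {H : Type*} [NormedAddCommGroup H] [InnerProductSpace ℝ H]
    {ι : Type*} {l : Filter ι} [l.NeBot] {u : ι → H} {a : ℝ}
    (hin : Tendsto (fun q : ι × ι => ⟪u q.1, u q.2⟫) (l ×ˢ l) (𝓝 a)) : Cauchy (map u l) := by
  have hdiag : Tendsto (fun i => ⟪u i, u i⟫) l (𝓝 a) := hin.comp (tendsto_id.prodMk tendsto_id)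
  rw [cauchy_map_iff]
  refine ⟨inferInstance, tendsto_uniformity_iff_dist_tendsto_zero.2 ?_⟩
  have h1 : Tendsto (fun q : ι × ι => ⟪u q.1, u q.1⟫) (l ×ˢ l) (𝓝 a) := hdiag.comp tendsto_fst
  have h2 : Tendsto (fun q : ι × ι => ⟪u q.2, u q.2⟫) (l ×ˢ l) (𝓝 a) := hdiag.comp tendsto_snd
  have h := ((h1.sub (hin.const_mul 2)).add h2).sqrt
  rw [show a - 2 * a + a = 0 by ring, Real.sqrt_zero] at h
  refine h.congr fun q => ?_
  rw [dist_eq_norm, ← Real.sqrt_sq (norm_nonneg (u q.1 - u q.2)), norm_sub_sq_real,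
    real_inner_self_eq_norm_sq, real_inner_self_eq_norm_sq]

/-- A family in `L²` whose inner products converge along the product filter converges in `L²`. -/
lemma exists_tendsto_eLpNorm_two {ι : Type*} {l : Filter ι} [l.NeBot] {X : ι → Ω → ℝ}
    (hX : ∀ᶠ i in l, MemLp (X i) 2 P) {a : ℝ}
    (hl : Tendsto (fun q : ι × ι => ∫ ω, X q.1 ω * X q.2 ω ∂P) (l ×ˢ l) (𝓝 a)) :
    ∃ L : Ω → ℝ, MemLp L 2 P ∧ Tendsto (fun i => eLpNorm (X i - L) 2 P) l (𝓝 0) := by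
  classical
  obtain ⟨u, hu⟩ : ∃ u : ι → Lp ℝ 2 P, ∀ i, MemLp (X i) 2 P → u i =ᵐ[P] X i := by
    refine ⟨fun i => if h : MemLp (X i) 2 P then h.toLp else 0, fun i h => ?_⟩
    beta_reduce
    rw [dif_pos h]
    exact h.coeFn_toLp
  have hin : Tendsto (fun q : ι × ι => ⟪u q.1, u q.2⟫) (l ×ˢ l) (𝓝 a) := by
    refine hl.congr' ?_
    filter_upwards [hX.prod_inl l, hX.prod_inr l] with q h1 h2
    rw [L2.inner_def]
    refine integral_congr_ae ?_
    filter_upwards [hu _ h1, hu _ h2] with ω e1 e2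
    rw [e1, e2, RCLike.inner_apply, conj_trivial, mul_comm]
  obtain ⟨L, hL⟩ := CompleteSpace.complete (cauchy_map_of_tendsto_inner hin)
  have hL' : Tendsto (fun i => eLpNorm (⇑(u i) - ⇑L) 2 P) l (𝓝 0) :=
    (Lp.tendsto_Lp_iff_tendsto_eLpNorm' u L).1 hL
  refine ⟨L, Lp.memLp L, hL'.congr' ?_⟩
  filter_upwards [hX] with i hi
  exact eLpNorm_congr_ae ((hu i hi).sub .rfl)

/-- Convergent even moments bound the family in `L^{2n}`. -/
lemma exists_eventually_eLpNorm_le {ι : Type*} {l : Filter ι} {X : ι → Ω → ℝ} {n : ℕ} (hn : n ≠ 0)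
    (hX : ∀ᶠ i in l, MemLp (X i) (2 * n : ℕ) P) {a : ℝ}
    (hl : Tendsto (fun i => ∫ ω, X i ω ^ (2 * n) ∂P) l (𝓝 a)) :
    ∃ C : ℝ≥0∞, C < ⊤ ∧ ∀ᶠ i in l, eLpNorm (X i) (2 * n : ℕ) P ≤ C := by
  refine ⟨ENNReal.ofReal (a + 1) ^ ((2 * n : ℕ) : ℝ)⁻¹,
    ENNReal.rpow_lt_top_of_nonneg (by positivity) ENNReal.ofReal_ne_top, ?_⟩
  have hpos : (0 : ℝ) < (2 * n : ℕ) := by positivity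
  filter_upwards [hX, hl.eventually (gt_mem_nhds (lt_add_one a))] with i hi hlt
  rw [ENNReal.le_rpow_inv_iff hpos]
  have h := eLpNorm_nnreal_pow_eq_lintegral (μ := P) (f := X i)
    (p := ((2 * n : ℕ) : ℝ≥0)) (by positivity)
  simp only [ENNReal.coe_natCast, NNReal.coe_natCast] at h
  rw [h]
  have hint : Integrable (fun ω => X i ω ^ (2 * n)) P := by
    refine (hi.integrable_norm_pow (by positivity)).congr (.of_forall fun ω => ?_)
    simp [pow_mul]
  have e : ∀ ω, ‖X i ω‖ₑ ^ ((2 * n : ℕ) : ℝ) = ENNReal.ofReal (X i ω ^ (2 * n)) := fun ω => by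
    rw [ENNReal.rpow_natCast, Real.enorm_eq_ofReal_abs, ← ENNReal.ofReal_pow (abs_nonneg _),
      pow_mul, sq_abs, ← pow_mul]
  simp_rw [e]
  rw [← ofReal_integral_eq_lintegral_ofReal hint
    (.of_forall fun ω => (even_two_mul n).pow_nonneg _)]
  exact ENNReal.ofReal_le_ofReal hlt.le

/-- Fatou's lemma: an `L²` limit inherits any eventual `L^q` bound. -/
lemma eLpNorm_le_of_tendsto_eLpNorm_two {ι : Type*} {l : Filter ι} [l.NeBot]
    [l.IsCountablyGenerated] {X : ι → Ω → ℝ} {L : Ω → ℝ} {q : ℝ≥0∞}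
    (hX : ∀ᶠ i in l, AEStronglyMeasurable (X i) P) (hL : AEStronglyMeasurable L P)
    (hl : Tendsto (fun i => eLpNorm (X i - L) 2 P) l (𝓝 0)) {C : ℝ≥0∞}
    (hC : ∀ᶠ i in l, eLpNorm (X i) q P ≤ C) : eLpNorm L q P ≤ C := by
  obtain ⟨v, hv⟩ := l.exists_seq_tendsto
  obtain ⟨N, hN⟩ := eventually_atTop.1 (hv.eventually (hX.and hC))
  have hv' : Tendsto (fun k => v (k + N)) atTop l := hv.comp (tendsto_add_atTop_nat N)
  have hm : ∀ k, AEStronglyMeasurable (X (v (k + N))) P := fun k => (hN _ (by omega)).1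
  obtain ⟨ns, -, hns⟩ := (tendstoInMeasure_of_tendsto_eLpNorm two_ne_zero hm hL
    (hl.comp hv')).exists_seq_tendsto_ae
  exact Lp.eLpNorm_le_of_ae_tendsto (u := atTop) (f := fun k => X (v (ns k + N)))
    (.of_forall fun k => (hN _ (by omega)).2) (fun k => hm (ns k)) hns

/-- The bound `x^r ≤ 1 + x^q` for `0 ≤ r ≤ q`, integrated; it covers `r = 0`, where no `L^r` norm is
available. -/
lemma lintegral_enorm_rpow_le [IsProbabilityMeasure P] {V : Ω → ℝ} {q : ℝ≥0} (hq : q ≠ 0) {r : ℝ}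
    (hr : 0 ≤ r) (hrq : r ≤ q) :
    ∫⁻ ω, ‖V ω‖ₑ ^ r ∂P ≤ 1 + eLpNorm V q P ^ (q : ℝ) := by
  have h : ∀ x : ℝ≥0∞, x ^ r ≤ 1 + x ^ (q : ℝ) := fun x => by
    rcases le_total x 1 with hx | hx
    · exact (ENNReal.rpow_le_one hx hr).trans le_self_add
    · exact (ENNReal.rpow_le_rpow_of_exponent_le hx hrq).trans le_add_self
  rw [eLpNorm_nnreal_pow_eq_lintegral hq]
  refine (lintegral_mono fun ω => h _).trans ?_
  rw [lintegral_add_left measurable_const]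
  simp

/-- The Cauchy-Schwarz inequality, with the second factor measured by an `L^q` norm. -/
lemma lintegral_enorm_mul_rpow_le [IsProbabilityMeasure P] {U V : Ω → ℝ}
    (hU : AEStronglyMeasurable U P) (hV : AEStronglyMeasurable V P) {q : ℝ≥0} (hq : q ≠ 0) {s : ℝ}
    (hs : 0 ≤ s) (hsq : s * 2 ≤ q) :
    ∫⁻ ω, ‖U ω‖ₑ * ‖V ω‖ₑ ^ s ∂P ≤
      eLpNorm U 2 P * (1 + eLpNorm V q P ^ (q : ℝ)) ^ (1 / 2 : ℝ) := by
  have h := ENNReal.lintegral_mul_le_Lp_mul_Lq P (p := 2) (q := 2) .two_two hU.enorm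
    (hV.enorm.pow_const s)
  refine h.trans ?_
  have e : (∫⁻ ω, ‖U ω‖ₑ ^ (2 : ℝ) ∂P) ^ (1 / 2 : ℝ) = eLpNorm U 2 P := by
    rw [eLpNorm_eq_lintegral_rpow_enorm_toReal two_ne_zero ENNReal.ofNat_ne_top]
    simp
  rw [e]
  gcongr
  simp_rw [← ENNReal.rpow_mul]
  exact lintegral_enorm_rpow_le hq (by positivity) hsq

section Convergence

variable [IsProbabilityMeasure P] {ι : Type*} {l : Filter ι} {X : ι → Ω → ℝ} {L : Ω → ℝ}

/-- `L²` convergence together with a bound in `L^q` gives `L^p` convergence for `2(p-1) ≤ q`. -/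
lemma tendsto_lintegral_enorm_sub_rpow (hX : ∀ᶠ i in l, AEStronglyMeasurable (X i) P)
    (hL : AEStronglyMeasurable L P) (hl : Tendsto (fun i => eLpNorm (X i - L) 2 P) l (𝓝 0))
    {q : ℝ≥0} (hq : 1 ≤ q) {C : ℝ≥0∞} (hCt : C < ⊤) (hC : ∀ᶠ i in l, eLpNorm (X i) q P ≤ C)
    (hLC : eLpNorm L q P ≤ C) {p : ℝ} (hp : 1 ≤ p) (hpq : (p - 1) * 2 ≤ q) :
    Tendsto (fun i => ∫⁻ ω, ‖X i ω - L ω‖ₑ ^ p ∂P) l (𝓝 0) := by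
  have hq0 : q ≠ 0 := (zero_lt_one.trans_le hq).ne'
  have hlim : Tendsto (fun i => eLpNorm (X i - L) 2 P *
      (1 + (C + C) ^ (q : ℝ)) ^ (1 / 2 : ℝ)) l (𝓝 0) := by
    have hK : (1 + (C + C) ^ (q : ℝ)) ^ (1 / 2 : ℝ) ≠ ⊤ := by
      finiteness
    simpa using ENNReal.Tendsto.mul_const hl (.inr hK)
  refine tendsto_of_tendsto_of_tendsto_of_le_of_le' tendsto_const_nhds hlim
    (.of_forall fun _ => zero_le) ?_
  filter_upwards [hX, hC] with i hi hiC
  have h := lintegral_enorm_mul_rpow_le (hi.sub hL) (hi.sub hL) hq0 (sub_nonneg.2 hp) hpq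
  have e : ∀ x : ℝ≥0∞, x * x ^ (p - 1) = x ^ p := fun x => by
    conv_lhs => rw [← ENNReal.rpow_one x, ← ENNReal.rpow_mul, one_mul]
    rw [← ENNReal.rpow_add_of_nonneg _ _ zero_le_one (sub_nonneg.2 hp), add_sub_cancel]
  simp only [Pi.sub_apply, e] at h
  refine h.trans ?_
  gcongr
  exact (eLpNorm_sub_le hi hL (by exact_mod_cast hq)).trans (add_le_add hiC hLC)

/-- `L²` convergence together with a bound in `L^q` gives convergence of the `n`-th moments for
`2(n-1) ≤ q`. -/
lemma tendsto_integral_pow (hX : ∀ᶠ i in l, AEStronglyMeasurable (X i) P)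
    (hL : AEStronglyMeasurable L P) (hl : Tendsto (fun i => eLpNorm (X i - L) 2 P) l (𝓝 0))
    {q : ℝ≥0} (hq : 1 ≤ q) {C : ℝ≥0∞} (hCt : C < ⊤) (hC : ∀ᶠ i in l, eLpNorm (X i) q P ≤ C)
    (hLC : eLpNorm L q P ≤ C) {n : ℕ} (hnq : ((n - 1 : ℕ) : ℝ) * 2 ≤ q)
    (hXn : ∀ᶠ i in l, Integrable (fun ω => X i ω ^ n) P) :
    Tendsto (fun i => ∫ ω, X i ω ^ n ∂P) l (𝓝 (∫ ω, L ω ^ n ∂P)) := by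
  have hq0 : q ≠ 0 := (zero_lt_one.trans_le hq).ne'
  refine tendsto_integral_of_L1 _ (hL.pow n) hXn ?_
  have hlim : Tendsto (fun i => n * (eLpNorm (X i - L) 2 P *
      (1 + (C + C) ^ (q : ℝ)) ^ (1 / 2 : ℝ))) l (𝓝 0) := by
    have hK : (1 + (C + C) ^ (q : ℝ)) ^ (1 / 2 : ℝ) ≠ ⊤ := by
      finiteness
    have h := ENNReal.Tendsto.mul_const hl (.inr hK)
    simpa using ENNReal.Tendsto.const_mul h (.inr (ENNReal.natCast_ne_top n))
  refine tendsto_of_tendsto_of_tendsto_of_le_of_le' tendsto_const_nhds hlim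
    (.of_forall fun _ => zero_le) ?_
  filter_upwards [hX, hC] with i hi hiC
  have h := lintegral_enorm_mul_rpow_le (hi.sub hL) (hi.norm.add hL.norm) hq0
    (Nat.cast_nonneg (n - 1)) hnq
  have hle : ∀ ω, ‖X i ω ^ n - L ω ^ n‖ₑ ≤
      n * (‖(X i - L) ω‖ₑ * ‖((fun ω => ‖X i ω‖) + fun ω => ‖L ω‖) ω‖ₑ ^ ((n - 1 : ℕ) : ℝ)) := by
    intro ω
    have h1 := abs_pow_sub_pow_le (a := X i ω) (b := L ω) (n := n)
    have h2 : |X i ω ^ n - L ω ^ n| ≤ n * (|X i ω - L ω| * |(|X i ω| + |L ω|)| ^ (n - 1)) := by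
      refine h1.trans ?_
      rw [mul_comm _ (n : ℝ), mul_assoc, abs_of_nonneg (a := |X i ω| + |L ω|) (by positivity)]
      gcongr
      exact max_le (le_add_of_nonneg_right (abs_nonneg _)) (le_add_of_nonneg_left (abs_nonneg _))
    simp only [Real.enorm_eq_ofReal_abs, Pi.sub_apply, Pi.add_apply, Real.norm_eq_abs,
      ENNReal.rpow_natCast]
    rw [← ENNReal.ofReal_natCast, ← ENNReal.ofReal_pow (abs_nonneg _),
      ← ENNReal.ofReal_mul (abs_nonneg _), ← ENNReal.ofReal_mul (Nat.cast_nonneg _)]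
    exact ENNReal.ofReal_le_ofReal h2
  refine (lintegral_mono hle).trans ?_
  rw [lintegral_const_mul' _ _ (ENNReal.natCast_ne_top n)]
  gcongr
  refine h.trans ?_
  gcongr
  refine (eLpNorm_add_le hi.norm hL.norm (by exact_mod_cast hq)).trans ?_
  rw [eLpNorm_norm, eLpNorm_norm]
  exact add_le_add hiC hLC

end Convergence

end ConvolutedLocalTime

/-! ### Convergence of the approximate local times -/

open ConvolutedLocalTime
theorem lemma4 {Ω : Type*} [MeasurableSpace Ω] (P : Measure Ω) [IsProbabilityMeasure P] (d : ℕ)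
    (B₁ B₂ : ℝ≥0 → Ω → EuclideanSpace ℝ (Fin d))
    (hB₁ : IsBrownian B₁ P) (hB₂ : IsBrownian B₂ P)
    (hB : IndepFun (fun ω u => B₁ u ω) (fun ω u => B₂ u ω) P)
    (f : EuclideanSpace ℝ (Fin d) → ℝ) (μ : Measure (EuclideanSpace ℝ (Fin d)))
    (hf : IsFourierTransformOf f μ)
    (t : ℝ) (ht : 0 < t) (η : ℝ → ℝ → ℝ)
    (hη_meas : AEMeasurable (fun q : ℝ × ℝ => η q.1 q.2)
      (volume.restrict (Set.Icc 0 t ×ˢ Set.Icc 0 t)))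
    (hη_nonneg : ∀ r ∈ Set.Icc 0 t, ∀ s ∈ Set.Icc 0 t, 0 ≤ η r s)
    (hη_symm : ∀ r ∈ Set.Icc 0 t, ∀ s ∈ Set.Icc 0 t, η r s = η (t - r) (t - s)) :
    -- part a)
    (alpha μ t η 2 < ⊤ →
      -- the approximations are well defined and square integrable
      (∀ ε > 0, (∀ᵐ ω ∂P, Integrable
          (fun q : ℝ × ℝ × EuclideanSpace ℝ (Fin d) =>
            integrand B₁ B₂ f η ε ω q.1 q.2.1 q.2.2)
          ((volume.restrict (Set.Icc 0 t)).prod ((volume.restrict (Set.Icc 0 t)).prod volume))) ∧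
        MemLp (approxLocalTime B₁ B₂ f t η ε) 2 P) ∧
      Tendsto (fun q : ℝ × ℝ => ∫ ω, approxLocalTime B₁ B₂ f t η q.1 ω *
          approxLocalTime B₁ B₂ f t η q.2 ω ∂P)
        (𝓝[>] 0 ×ˢ 𝓝[>] 0) (𝓝 (alpha μ t η 2).toReal) ∧
      ∃ L : Ω → ℝ, MemLp L 2 P ∧
        Tendsto (fun ε => eLpNorm (approxLocalTime B₁ B₂ f t η ε - L) 2 P) (𝓝[>] 0) (𝓝 0)) ∧
    -- part b), for the (almost surely unique) limit `L` from part a)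
    ((∀ n : ℕ, 1 ≤ n → alpha μ t η n < ⊤) →
      ∀ L : Ω → ℝ, MemLp L 2 P →
        Tendsto (fun ε => eLpNorm (approxLocalTime B₁ B₂ f t η ε - L) 2 P) (𝓝[>] 0) (𝓝 0) →
        (∀ p : ℝ, 2 ≤ p →
          (∀ ε > 0, MemLp (approxLocalTime B₁ B₂ f t η ε) (ENNReal.ofReal p) P) ∧
          MemLp L (ENNReal.ofReal p) P ∧
          Tendsto (fun ε => ∫⁻ ω, ‖approxLocalTime B₁ B₂ f t η ε ω - L ω‖ₑ ^ p ∂P)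
            (𝓝[>] 0) (𝓝 0)) ∧
        (∀ n : ℕ, 1 ≤ n →
          Tendsto (fun ε => ∫ ω, approxLocalTime B₁ B₂ f t η ε ω ^ n ∂P)
            (𝓝[>] 0) (𝓝 (alpha μ t η n).toReal) ∧
          ∫ ω, L ω ^ n ∂P = (alpha μ t η n).toReal)) := by
  have hσ := sigmaFinite_of_hasTemperateGrowth hf.temperate
  have hηm : AEStronglyMeasurable (fun q : ℝ × ℝ => η q.1 q.2) (squareMeasure t) := by
    rw [squareMeasure, Measure.prod_restrict]
    exact hη_meas.aestronglyMeasurable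
  have hηi : alpha μ t η 2 < ⊤ →
      Integrable (fun q : ℝ × ℝ => η q.1 q.2) (squareMeasure t) ∨ μ = 0 := fun hα =>
    or_iff_not_imp_right.2 (integrable_of_alpha_two_lt_top hηm hη_nonneg hα)
  have hpos : ∀ᶠ ε : ℝ in 𝓝[>] 0, 0 < ε := eventually_mem_nhdsWithin
  have hzero : Tendsto (fun ε : ℝ => ε) (𝓝[>] 0) (𝓝 0) := tendsto_id.mono_right nhdsWithin_le_nhds
  refine ⟨fun hα => ?_, fun hα L hL hlim => ?_⟩
  · have hη := hηi hα
    have hmem : ∀ ε > 0, MemLp (approxLocalTime B₁ B₂ f t η ε) 2 P := fun ε hε =>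
      memLp_approxLocalTime hB₁ hB₂ hf hη hε 2
    have hmom : Tendsto (fun q : ℝ × ℝ => ∫ ω, approxLocalTime B₁ B₂ f t η q.1 ω *
        approxLocalTime B₁ B₂ f t η q.2 ω ∂P) (𝓝[>] 0 ×ˢ 𝓝[>] 0)
        (𝓝 (alpha μ t η 2).toReal) := by
      have hpos2 : ∀ᶠ q : ℝ × ℝ in 𝓝[>] 0 ×ˢ 𝓝[>] 0, ∀ j, 0 < ![q.1, q.2] j := by
        filter_upwards [hpos.prod_inl _, hpos.prod_inr _] with q h1 h2
        simpa [Fin.forall_fin_two] using ⟨h1, h2⟩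
      refine (tendsto_integral_prod_weight hηm hη_nonneg hα hpos2 ?_).congr' ?_
      · simpa [Fin.forall_fin_two] using
          ⟨hzero.comp tendsto_fst, hzero.comp tendsto_snd⟩
      · filter_upwards [hpos2] with q hq
        rw [← integral_prod_approxLocalTime hB₁ hB₂ hB hf hη hq]
        simp
    exact ⟨fun ε hε => ⟨ae_integrable_integrand hB₁ hB₂ hf hη hε, hmem ε hε⟩, hmom,
      exists_tendsto_eLpNorm_two (hpos.mono hmem) hmom⟩
  · have hη := hηi (hα 2 one_le_two)
    have hmem : ∀ ε > 0, ∀ p, MemLp (approxLocalTime B₁ B₂ f t η ε) p P := fun ε hε p =>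
      memLp_approxLocalTime hB₁ hB₂ hf hη hε p
    have hmeas : ∀ᶠ ε in 𝓝[>] 0, AEStronglyMeasurable (approxLocalTime B₁ B₂ f t η ε) P :=
      hpos.mono fun ε hε => (hmem ε hε 2).1
    have hmom : ∀ n : ℕ, 1 ≤ n → Tendsto (fun ε => ∫ ω, approxLocalTime B₁ B₂ f t η ε ω ^ n ∂P)
        (𝓝[>] 0) (𝓝 (alpha μ t η n).toReal) := fun n hn => by
      refine (tendsto_integral_prod_weight hηm hη_nonneg (hα n hn) (e := fun ε _ => ε)
        (hpos.mono fun ε hε _ => hε) fun _ => hzero).congr' ?_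
      filter_upwards [hpos] with ε hε
      rw [← integral_prod_approxLocalTime hB₁ hB₂ hB hf hη fun _ => hε]
      simp
    have hbound : ∀ n : ℕ, n ≠ 0 → ∃ C : ℝ≥0∞, C < ⊤ ∧
        (∀ᶠ ε in 𝓝[>] 0, eLpNorm (approxLocalTime B₁ B₂ f t η ε) ((2 * n : ℕ) : ℝ≥0) P ≤ C) ∧
        eLpNorm L ((2 * n : ℕ) : ℝ≥0) P ≤ C := fun n hn => by
      obtain ⟨C, hCt, hC⟩ := exists_eventually_eLpNorm_le hn
        (hpos.mono fun ε hε => hmem ε hε _) (hmom (2 * n) (by omega))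
      rw [ENNReal.coe_natCast]
      exact ⟨C, hCt, hC, eLpNorm_le_of_tendsto_eLpNorm_two hmeas hL.1 hlim hC⟩
    refine ⟨fun p hp => ⟨fun ε hε => hmem ε hε _, ?_⟩, fun n hn => ⟨hmom n hn, ?_⟩⟩
    · -- With `n ≥ p` both `p ≤ 2n` and `2(p - 1) ≤ 2n` hold, so a bound in `L^{2n}` suffices.
      obtain ⟨n, hn⟩ := exists_nat_ge p
      have hn0 : n ≠ 0 := by
        rintro rfl
        norm_num at hn
        linarith
      have hq : (1 : ℝ≥0) ≤ (2 * n : ℕ) := by exact_mod_cast (by omega : 1 ≤ 2 * n)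
      obtain ⟨C, hCt, hC, hLC⟩ := hbound n hn0
      refine ⟨?_, tendsto_lintegral_enorm_sub_rpow hmeas hL.1 hlim hq hCt hC hLC (by linarith) ?_⟩
      · refine MemLp.mono_exponent (q := ((2 * n : ℕ) : ℝ≥0)) ⟨hL.1, hLC.trans_lt hCt⟩ ?_
        rw [ENNReal.coe_natCast, ← ENNReal.ofReal_natCast]
        refine ENNReal.ofReal_le_ofReal ?_
        push_cast
        linarith
      · push_cast
        linarith
    · obtain ⟨C, hCt, hC, hLC⟩ := hbound n (by omega)
      have hq : (1 : ℝ≥0) ≤ (2 * n : ℕ) := by exact_mod_cast (by omega : 1 ≤ 2 * n)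
      refine tendsto_nhds_unique (tendsto_integral_pow hmeas hL.1 hlim hq hCt hC hLC ?_ ?_)
        (hmom n hn)
      · rw [NNReal.coe_natCast]
        exact_mod_cast (by omega : (n - 1) * 2 ≤ 2 * n)
      · filter_upwards [hpos] with ε hε
        refine (hmem ε hε n).integrable_norm_pow (by omega) |>.mono
          ((hmem ε hε n).1.pow n) (.of_forall fun ω => ?_)
        simp
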